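/- A semilinear space is a set $X$ with a commutative associative addition having a neutral element $\theta$ and a multiplication by real numbers such that $\alpha(x+y)=\alpha x+\alpha y$, $\alpha(\beta x)=(\alpha\beta)x$, $1\cdot x=x$, $0\cdot x=\theta$. An element $x\in X$ is convex if $(\alpha+\beta)x=\alpha x+\beta x$ for all $\alpha,\beta\ge 0$, and invertible if $x+x'=\theta$ for some $x'\in X$. An $L$-space is a semilinear space with a metric $h_X$ in which it is complete and separable and such that $h_X(\alpha x,\alpha y)=|\alpha|h_X(x,y)$ and $h_X(x+z,y+z)\le h_X(x,y)$ for all $x,y,z\in X$, $\alpha\in\mathbb R$; it is isotropic if $h_X(x+z,y+z)=h_X(x,y)$ for all $x,y,z\in X$. A convexifying operator on $X$ is a map $P$ from $X$ onto the set of all convex elements such that $h_X(P(x),P(y))\le h_X(x,y)$, $P\circ P=P$, and $P(\alpha x+\beta y)=\alpha P(x)+\beta P(y)$. Given $P$, the integral over $[a,b]$ of a simple mapping with values $f_1,\dots,f_n$ on disjoint measurable sets $T_1,\dots,T_n$ with union $[a,b]$ is $\sum_i \mu(T_i)P(f_i)$ ($\mu$ is Lebesgue measure), and the integral of a uniform limit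 of simple mappings is the limit of their integrals. Let $X$ be an $L$-space with a convexifying operator $P$. Let $\omega\colon[0,\infty)\to\mathbb R$ be a modulus of continuity, i.e. a non-decreasing continuous function with $\omega(0)=0$ and $\omega(s+t)\le\omega(s)+\omega(t)$, and let $H^\omega([a,b],X)$ be the class of $f\colon[a,b]\to X$ with $h_X(f(s),f(t))\le\omega(|s-t|)$ for all $s,t\in[a,b]$. For $\alpha,\beta\ge0$ put $I(\alpha,\beta)=\int_\alpha^\beta\omega(s)\,ds$. **Theorem.** Let $a<b$, $c<d$, $a\le c$, $M=\max\{b-a,d-c\}$, $m=\min\{b-a,d-c\}$. Then for every $f\in H^\omega([a,\max\{b,d\}],X)$ the integrals of $f$ over $[a,b]$ and over $[c,d]$ exist and $$ h_X\left(\frac1{b-a}\int_a^b f(t)\,dt,\ \frac1{d-c}\int_c^d f(t)\,dt\right)\le \begin{cases} \frac{M-m}{M^2}\left\{I\left(0,\frac{M(c-a)}{M-m}\right)+I\left(0,\frac{M(b-d)}{M-m}\right)\right\}, & [c,d]\subset[a,b],\\ \frac1{M+m}I\left(\frac{M(b-c)}{m},d-a\right)+\frac{M-m}{M^2}I\left(0,\frac{M(b-c)}{m}\right),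 & b\in[c,d],\\ \frac1{M+m}I(c-b,d-a), & c\ge b, \end{cases} $$ where the first bound is understood as $0$ if $M=m$ (that is, if $[c,d]=[a,b]$). If $X$ is isotropic and has a convex invertible element different from $\theta$, and $\omega$ is concave, then the inequality is sharp: in each case there is $f\in H^\omega([a,\max\{b,d\}],X)$ for which it is an equality. -/

import Mathlib

open Set Filter Topology MeasureTheory

/-- A semilinear space: a commutative additive monoid with a multiplication by real numbers such that
`α (x + y) = α x + α y`, `α (β x) = (α β) x`, `1 x = x`, `0 x = θ`.
The law `(α + β) x = α x + β x` is not required. -/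
class SemilinearSpace (X : Type*) [AddCommMonoid X] extends DistribMulAction ℝ X where
  zero_real_smul : ∀ x : X, (0 : ℝ) • x = 0

/-- An `L`-space: a complete separable semilinear metric space whose metric is absolutely
homogeneous and is not increased by adding an element to both arguments. -/
class LSpace (X : Type*) [AddCommMonoid X] [MetricSpace X] extends
    SemilinearSpace X, CompleteSpace X, TopologicalSpace.SeparableSpace X where
  dist_real_smul : ∀ (α : ℝ) (x y : X), dist (α • x) (α • y) = |α| * dist x y
  dist_add_right_le : ∀ x y z : X, dist (x + z) (y + z) ≤ dist x y

namespace LSpace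

section
variable (X : Type*) [AddCommMonoid X] [MetricSpace X]

/-- The metric is invariant under addition. -/
def Isotropic : Prop := ∀ x y z : X, dist (x + z) (y + z) = dist x y

end

section
variable {X : Type*} [AddCommMonoid X] [MetricSpace X] [LSpace X]

/-- Convex elements: `(α + β) x = α x + β x` for all `α, β ≥ 0`. -/
def IsConvexElement (x : X) : Prop :=
  ∀ α β : ℝ, 0 ≤ α → 0 ≤ β → (α + β) • x = α • x + β • x

/-- Convexifying operators: nonexpansive linear idempotent surjections of `X` onto the set of
its convex elements. -/
structure IsConvexifying (P : X → X) : Prop where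
  range_eq : range P = {x : X | IsConvexElement x}
  dist_le : ∀ x y : X, dist (P x) (P y) ≤ dist x y
  idem : ∀ x : X, P (P x) = P x
  linear : ∀ (α β : ℝ) (x y : X), P (α • x + β • y) = α • P x + β • P y

/-- The integral over `[a, b]` of a simple mapping: the sum of `μ(T_i) P(f_i)` over its values `f_i`,
where `T_i` is the part of `[a, b]` on which the value `f_i` is taken and `μ` is
Lebesgue measure. -/
noncomputable def simpleIntegral (P : X → X) (s : SimpleFunc ℝ X) (a b : ℝ) : X :=
  ∑ x ∈ s.range, (volume.real (s ⁻¹' {x} ∩ Icc a b)) • P x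

/-- `f` is on `[a, b]` a uniform limit of simple mappings, and for every sequence of simple mappings
which converges to `f` uniformly on `[a, b]` the integrals converge to `J`. -/
def HasIntegral (P : X → X) (f : ℝ → X) (a b : ℝ) (J : X) : Prop :=
  (∃ s : ℕ → SimpleFunc ℝ X, TendstoUniformlyOn (fun n => ⇑(s n)) f atTop (Icc a b)) ∧
  ∀ s : ℕ → SimpleFunc ℝ X, TendstoUniformlyOn (fun n => ⇑(s n)) f atTop (Icc a b) →
    Tendsto (fun n => simpleIntegral P (s n) a b) atTop (𝓝 J)

/-- The integral of `f` over `[a, b]` exists. -/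
def IsIntegrable (P : X → X) (f : ℝ → X) (a b : ℝ) : Prop :=
  ∃ J : X, HasIntegral P f a b J

open Classical in
/-- The integral of `f` over `[a, b]` (and `θ` if it does not exist). -/
noncomputable def integral (P : X → X) (f : ℝ → X) (a b : ℝ) : X :=
  if h : IsIntegrable P f a b then h.choose else 0

theorem HasIntegral.unique {P : X → X} {f : ℝ → X} {a b : ℝ} {J K : X}
    (hJ : HasIntegral P f a b J) (hK : HasIntegral P f a b K) : J = K := by
  obtain ⟨s, hs⟩ := hJ.1
  exact tendsto_nhds_unique (hJ.2 s hs) (hK.2 s hs)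

theorem HasIntegral.integral_eq {P : X → X} {f : ℝ → X} {a b : ℝ} {J : X}
    (hJ : HasIntegral P f a b J) : integral P f a b = J := by
  have h : IsIntegrable P f a b := ⟨J, hJ⟩
  rw [integral, dif_pos h]
  exact h.choose_spec.unique hJ

end

/-- The mean value of `f` over `[a, b]`. -/
noncomputable def mean {X : Type*} [AddCommMonoid X] [MetricSpace X] [LSpace X]
    (P : X → X) (f : ℝ → X) (a b : ℝ) : X :=
  (1 / (b - a)) • integral P f a b

end LSpace

/-- A modulus of continuity on `[0, ∞)`. Values of `ω` at negative numbers play no role. -/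
structure IsModulusOfContinuity (ω : ℝ → ℝ) : Prop where
  map_zero : ω 0 = 0
  monotoneOn : MonotoneOn ω (Ici 0)
  continuousOn : ContinuousOn ω (Ici 0)
  subadditive : ∀ s t : ℝ, 0 ≤ s → 0 ≤ t → ω (s + t) ≤ ω s + ω t

/-- The class `H^ω([a, b], X)`. Values of the functions outside `[a, b]` play no role. -/
def ClassH (ω : ℝ → ℝ) (a b : ℝ) (X : Type*) [MetricSpace X] : Set (ℝ → X) :=
  {f | ∀ s ∈ Icc a b, ∀ t ∈ Icc a b, dist (f s) (f t) ≤ ω |s - t|}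

/-- `I(α, β) = ∫_α^β ω(s) ds`. -/
noncomputable def modulusIntegral (ω : ℝ → ℝ) (α β : ℝ) : ℝ := ∫ s in α..β, ω s

namespace LSpace

/-! ### Metric inequalities and convex elements in L-spaces. -/

section Algebra

variable {X : Type*} [AddCommMonoid X] [MetricSpace X] [LSpace X]

/-! The estimate is an optimal transport argument. The two means spread unit mass with constant
density over `[a, b]` and over `[c, d]`. Integrals of simple mappings are convex elements, so
densities may be split, and the mass common to both intervals is dropped because adding an element
does not increase distances. The surplus is carried by antimonotone pairings of intervals `[x, z]`
and `[z', y]`: the point moving left from `z` is matched with the point moving right from `z'`, both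
at constant speed, so the distance of matched points runs linearly from `z' - z` to `y - x` and the
cost is a constant times `I(z' - z, y - x)` (`dist_smul_simpleIntegral_le`). Disjoint intervals need
one pairing and the other cases two; the cut point `x` is fixed by balance of mass. All this is done
for simple mappings that satisfy the modulus condition up to `ε`, and `dist_mean_le_of_simple`
passes to the limit.

For sharpness, every matched pair must realise `ω` exactly. If the matched points recede from a
centre with speeds in ratio `l : 1 - l`, the function `kink` does this, and concavity of `ω` keeps
it in the class (`hasModulus_kink`). Overlapping intervals give nested pairings, whose kinks are
glued (`HasModulus.glue`); nested intervals give side-by-side pairings, whose kinks are joined into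
a peak by a minimum. The real extremal function, shifted to be nonnegative, multiplies a nonzero
convex element: in an isotropic space the ray through it is a scaled copy of the half-line. -/

theorem dist_add_add_le_add (x y z w : X) : dist (x + y) (z + w) ≤ dist x z + dist y w := by
  refine (dist_triangle _ (z + y) _).trans (add_le_add (dist_add_right_le x z y) ?_)
  rw [add_comm z y, add_comm z w]
  exact dist_add_right_le y w z

theorem dist_finset_sum_le {ι : Type*} (S : Finset ι) (f g : ι → X) :
    dist (∑ i ∈ S, f i) (∑ i ∈ S, g i) ≤ ∑ i ∈ S, dist (f i) (g i) := by
  classical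
  induction S using Finset.induction_on with
  | empty => simp
  | insert i S hi ih =>
    rw [Finset.sum_insert hi, Finset.sum_insert hi, Finset.sum_insert hi]
    exact (dist_add_add_le_add _ _ _ _).trans (add_le_add le_rfl ih)

theorem IsConvexElement.sum_smul {x : X} (hx : IsConvexElement x) {ι : Type*} (S : Finset ι)
    (w : ι → ℝ) (hw : ∀ i ∈ S, 0 ≤ w i) : (∑ i ∈ S, w i) • x = ∑ i ∈ S, w i • x := by
  classical
  induction S using Finset.induction_on with
  | empty => simpa using SemilinearSpace.zero_real_smul x
  | insert i S hi ih =>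
    have hS : ∀ j ∈ S, 0 ≤ w j := fun j hj => hw j (Finset.mem_insert_of_mem hj)
    rw [Finset.sum_insert hi, Finset.sum_insert hi,
      hx _ _ (hw i (Finset.mem_insert_self i S)) (Finset.sum_nonneg hS), ih hS]

theorem IsConvexElement.smul {x : X} (hx : IsConvexElement x) (r : ℝ) :
    IsConvexElement (r • x) := by
  intro α β hα hβ
  rw [smul_comm, hx α β hα hβ, smul_add, smul_comm r α, smul_comm r β]

theorem IsConvexElement.sum {ι : Type*} (S : Finset ι) (f : ι → X)
    (hf : ∀ i ∈ S, IsConvexElement (f i)) : IsConvexElement (∑ i ∈ S, f i) := by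
  intro α β hα hβ
  simp only [Finset.smul_sum]
  rw [← Finset.sum_add_distrib]
  exact Finset.sum_congr rfl fun i hi => hf i hi α β hα hβ

/-- The smaller multiple is a common summand of both points, and isotropy cancels it. Hence scalar
problems on the half-line transfer to the ray through `x`. -/
theorem IsConvexElement.dist_smul_smul {x : X} (hX : Isotropic X) (hx : IsConvexElement x)
    {α β : ℝ} (hα : 0 ≤ α) (hβ : 0 ≤ β) : dist (α • x) (β • x) = |α - β| * dist x 0 := by
  have key : ∀ α β : ℝ, 0 ≤ β → β ≤ α → dist (α • x) (β • x) = |α - β| * dist x 0 := by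
    intro α β hβ h
    have h1 : α • x = (α - β) • x + β • x := by
      rw [← hx _ _ (sub_nonneg.2 h) hβ, sub_add_cancel]
    have h2 : β • x = 0 + β • x := (zero_add _).symm
    have h3 : (0 : X) = (α - β) • (0 : X) := (smul_zero _).symm
    rw [h1]
    conv_lhs => rw [h2, ← add_assoc, add_zero]
    rw [hX]
    conv_lhs => rw [h3]
    exact dist_real_smul _ _ _
  rcases le_total β α with h | h
  · exact key α β hβ h
  · rw [dist_comm, abs_sub_comm]
    exact key β α hα h

theorem continuous_real_smul (r : ℝ) : Continuous fun x : X => r • x :=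
  (LipschitzWith.of_dist_le_mul (K := ⟨|r|, abs_nonneg r⟩) fun x y =>
    (dist_real_smul r x y).le).continuous

namespace IsConvexifying

variable {P : X → X}

theorem isConvexElement (hP : IsConvexifying P) (x : X) : IsConvexElement (P x) := by
  have h : P x ∈ range P := mem_range_self x
  rwa [hP.range_eq] at h

theorem apply_eq_self (hP : IsConvexifying P) {x : X} (hx : IsConvexElement x) : P x = x := by
  have h : x ∈ range P := by rwa [hP.range_eq]
  obtain ⟨y, rfl⟩ := h
  exact hP.idem y

end IsConvexifying

end Algebra

/-! ### Integrals of simple mappings as weighted sums. -/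

section WeightedSum

variable {X : Type*} [AddCommMonoid X] [MetricSpace X] [LSpace X]
variable {Ω : Type*} [MeasurableSpace Ω]

/-- The integral of a simple mapping with respect to an arbitrary measure. -/
noncomputable def weightedSum (P : X → X) (μ : Measure Ω) (s : SimpleFunc Ω X) : X :=
  ∑ x ∈ s.range, μ.real (s ⁻¹' {x}) • P x

theorem simpleIntegral_eq_weightedSum (P : X → X) (s : SimpleFunc ℝ X) (a b : ℝ) :
    simpleIntegral P s a b = weightedSum P (volume.restrict (Icc a b)) s := by
  unfold simpleIntegral weightedSum
  refine Finset.sum_congr rfl fun x _ => ?_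
  rw [measureReal_restrict_apply (s.measurableSet_fiber x)]

variable {P : X → X}

/-- The map `g` may merge several fibres of `u` into one. Adding their measures in front of one
element is legitimate because `P (g y)` is convex; this lets the sum be computed over any finer
partition. -/
theorem weightedSum_map (hP : IsConvexifying P) (μ : Measure Ω) [IsFiniteMeasure μ] {Y : Type*}
    (u : SimpleFunc Ω Y) (g : Y → X) :
    weightedSum P μ (u.map g) = ∑ y ∈ u.range, μ.real (u ⁻¹' {y}) • P (g y) := by
  classical
  unfold weightedSum
  rw [SimpleFunc.range_map]
  refine Finset.sum_image' _ fun b _ => ?_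
  rw [SimpleFunc.map_preimage_singleton, ← Finset.set_biUnion_preimage_singleton,
    measureReal_biUnion_finset]
  · rw [(hP.isConvexElement (g b)).sum_smul _ _ fun _ _ => measureReal_nonneg]
    refine Finset.sum_congr rfl fun y hy => ?_
    rw [(Finset.mem_filter.1 hy).2]
  · intro y _ z _ hyz
    exact Disjoint.preimage _ (by simpa using hyz)
  · exact fun y _ => u.measurableSet_fiber y

theorem sum_measureReal_mul_eq_integral (μ : Measure Ω) [IsFiniteMeasure μ] {Y : Type*}
    (u : SimpleFunc Ω Y) (g : Y → ℝ) :
    ∑ y ∈ u.range, μ.real (u ⁻¹' {y}) * g y = ∫ x, g (u x) ∂μ := by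
  classical
  have h : ∀ x, g (u x) = ∑ y ∈ u.range, (u ⁻¹' {y}).indicator (fun _ => g y) x := by
    intro x
    rw [Finset.sum_eq_single (u x)]
    · simp
    · intro y _ hy
      exact indicator_of_notMem (fun hx => hy (by simpa using hx.symm)) _
    · intro hx
      exact absurd (u.mem_range_self x) hx
  simp_rw [h]
  rw [integral_finsetSum]
  · refine Finset.sum_congr rfl fun y _ => ?_
    rw [integral_indicator_const _ (u.measurableSet_fiber y), smul_eq_mul]
  · exact fun y _ => (integrable_const _).indicator (u.measurableSet_fiber y)

theorem integrable_comp_simpleFunc (μ : Measure Ω) [IsFiniteMeasure μ] {Y : Type*}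
    (u : SimpleFunc Ω Y) (g : Y → ℝ) : Integrable (fun x => g (u x)) μ :=
  SimpleFunc.integrable_of_isFiniteMeasure (u.map g)

/-- Over the common refinement `s.pair r` both sums have the same coefficients, so they can be
compared term by term with `P` nonexpansive. -/
theorem dist_weightedSum_le (hP : IsConvexifying P) (μ : Measure Ω) [IsFiniteMeasure μ]
    (s r : SimpleFunc Ω X) :
    dist (weightedSum P μ s) (weightedSum P μ r) ≤ ∫ x, dist (s x) (r x) ∂μ := by
  have hs : s = (s.pair r).map Prod.fst := by ext; rfl
  have hr : r = (s.pair r).map Prod.snd := by ext; rfl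
  have h := sum_measureReal_mul_eq_integral μ (s.pair r) fun p => dist p.1 p.2
  simp only [SimpleFunc.pair_apply] at h
  rw [← h]
  have h1 := weightedSum_map hP μ (s.pair r) Prod.fst
  have h2 := weightedSum_map hP μ (s.pair r) Prod.snd
  rw [← hs] at h1
  rw [← hr] at h2
  rw [h1, h2]
  refine (dist_finset_sum_le _ _ _).trans (Finset.sum_le_sum fun p _ => ?_)
  rw [dist_real_smul, abs_of_nonneg measureReal_nonneg]
  exact mul_le_mul_of_nonneg_left (hP.dist_le _ _) measureReal_nonneg

theorem weightedSum_eq_sum_of_subset (P : X → X) (μ : Measure Ω) (s : SimpleFunc Ω X)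
    {S : Finset X} (hS : s.range ⊆ S) :
    weightedSum P μ s = ∑ x ∈ S, μ.real (s ⁻¹' {x}) • P x := by
  refine Finset.sum_subset hS fun x _ hx => ?_
  rw [SimpleFunc.preimage_eq_empty_iff s x |>.2 hx, measureReal_empty]
  exact SemilinearSpace.zero_real_smul _

end WeightedSum

/-! ### Additivity and affine change of variable. -/

section SimpleIntegral

variable {X : Type*} [AddCommMonoid X] [MetricSpace X] [LSpace X] {P : X → X}

theorem isConvexElement_simpleIntegral (hP : IsConvexifying P) (s : SimpleFunc ℝ X) (a b : ℝ) :
    IsConvexElement (simpleIntegral P s a b) :=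
  IsConvexElement.sum _ _ fun _ _ => (hP.isConvexElement _).smul _

theorem simpleIntegral_add (hP : IsConvexifying P) (s : SimpleFunc ℝ X) {a b c : ℝ} (hab : a ≤ b)
    (hbc : b ≤ c) :
    simpleIntegral P s a b + simpleIntegral P s b c = simpleIntegral P s a c := by
  unfold simpleIntegral
  rw [← Finset.sum_add_distrib]
  refine Finset.sum_congr rfl fun x _ => ?_
  rw [← hP.isConvexElement x _ _ measureReal_nonneg measureReal_nonneg]
  congr 1
  have hfin : ∀ u v : ℝ, volume (s ⁻¹' {x} ∩ Icc u v) ≠ ⊤ := fun u v =>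
    measure_ne_top_of_subset inter_subset_right (by simp)
  rw [← Icc_union_Icc_eq_Icc hab hbc, inter_union_distrib_left]
  refine (measureReal_union₀ ((s.measurableSet_fiber x).inter measurableSet_Icc).nullMeasurableSet
    ?_ (hfin _ _) (hfin _ _)).symm
  have h : (s ⁻¹' {x} ∩ Icc a b) ∩ (s ⁻¹' {x} ∩ Icc b c) ⊆ {b} := by
    rintro t ⟨⟨_, h1⟩, ⟨_, h2⟩⟩
    exact le_antisymm h1.2 h2.1
  exact measure_mono_null h (by simp)

theorem measureReal_preimage_affine {k : ℝ} (hk : k ≠ 0) (l : ℝ) (B : Set ℝ) :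
    |k| * volume.real ((fun t => k * t + l) ⁻¹' B) = volume.real B := by
  have h : (fun t => k * t + l) ⁻¹' B = (fun t => k * t) ⁻¹' ((fun t => t + l) ⁻¹' B) := rfl
  rw [measureReal_def, h, Real.volume_preimage_mul_left hk, measure_preimage_add_right,
    ENNReal.toReal_mul, ENNReal.toReal_ofReal (abs_nonneg _), abs_inv, ← mul_assoc,
    mul_inv_cancel₀ (abs_ne_zero.2 hk), one_mul, measureReal_def]

/-- Precomposition of a simple mapping with an affine map. -/
noncomputable def compAffine (s : SimpleFunc ℝ X) (k l : ℝ) : SimpleFunc ℝ X :=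
  s.comp (fun t => k * t + l) (by fun_prop)

/-- Brings every interval to `[0, 1]`, so that two intervals of different length can be compared
pointwise. Negative `k` reverses the orientation; `k = 0` is kept because the pairings may
degenerate to single points. -/
theorem simpleIntegral_compAffine (s : SimpleFunc ℝ X) {k : ℝ} (l : ℝ) {x y : ℝ}
    (hk : |k| = y - x) (h : k ≠ 0 → ∀ t, k * t + l ∈ Icc x y ↔ t ∈ Icc (0 : ℝ) 1) :
    simpleIntegral P s x y = (y - x) • simpleIntegral P (compAffine s k l) 0 1 := by
  rcases eq_or_ne k 0 with rfl | hk0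
  · have hxy' : y - x = 0 := by rw [← hk, abs_zero]
    have h0 : y = x := by linarith
    rw [hxy', SemilinearSpace.zero_real_smul, h0]
    refine Finset.sum_eq_zero fun z _ => ?_
    have : volume.real (s ⁻¹' {z} ∩ Icc x x) = 0 := by
      rw [measureReal_def, measure_mono_null (t := {x}) (by simp) (by simp), ENNReal.toReal_zero]
    rw [this, SemilinearSpace.zero_real_smul]
  · have hsub : (compAffine s k l).range ⊆ s.range := s.range_comp_subset_range _
    rw [simpleIntegral_eq_weightedSum P (compAffine s k l), weightedSum_eq_sum_of_subset P _ _ hsub,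
      Finset.smul_sum]
    refine Finset.sum_congr rfl fun z _ => ?_
    rw [smul_smul, ← hk, measureReal_restrict_apply (SimpleFunc.measurableSet_fiber _ z),
      ← measureReal_preimage_affine hk0 l]
    congr 3
    ext t
    simp only [mem_preimage, mem_inter_iff, h hk0 t]
    rfl

end SimpleIntegral

end LSpace

namespace LSpace

/-! ### The antimonotone transport estimate. -/

section Transport

variable {X : Type*} [AddCommMonoid X] [MetricSpace X] [LSpace X] {P : X → X}

theorem simpleIntegral_eq_smul (s : SimpleFunc ℝ X) {x y : ℝ} (hxy : x ≤ y) :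
    simpleIntegral P s x y = (y - x) • simpleIntegral P (compAffine s (y - x) x) 0 1 := by
  refine simpleIntegral_compAffine s x (abs_of_nonneg (by linarith)) fun h t => ?_
  have hpos : 0 < y - x := lt_of_le_of_ne (by linarith) h.symm
  constructor
  · rintro ⟨h1, h2⟩
    constructor <;> nlinarith
  · rintro ⟨h1, h2⟩
    constructor <;> nlinarith

theorem simpleIntegral_eq_smul_reflect (s : SimpleFunc ℝ X) {x y : ℝ} (hxy : x ≤ y) :
    simpleIntegral P s x y = (y - x) • simpleIntegral P (compAffine s (-(y - x)) y) 0 1 := by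
  refine simpleIntegral_compAffine s y (by rw [abs_neg, abs_of_nonneg (by linarith)]) fun h t => ?_
  have hpos : 0 < y - x := lt_of_le_of_ne (by linarith) (neg_ne_zero.1 h).symm
  constructor
  · rintro ⟨h1, h2⟩
    constructor <;> nlinarith
  · rintro ⟨h1, h2⟩
    constructor <;> nlinarith

/-- The antimonotone pairing of `[x, z]` with `[z', y]` bounds the distance between the integrals
over these intervals, weighted so that both carry the same mass. -/
theorem dist_smul_simpleIntegral_le (hP : IsConvexifying P) {ω : ℝ → ℝ}
    (hω : ContinuousOn ω (Ici 0)) (s : SimpleFunc ℝ X) {x z z' y α β κ ε : ℝ} (hxz : x ≤ z)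
    (hzz : z ≤ z') (hzy : z' ≤ y) (hα : 0 ≤ α) (hε : 0 ≤ ε)
    (hαβ : α * (z - x) = β * (y - z')) (hκ : κ * (z - x + (y - z')) = α * (z - x))
    (hα1 : α * (z - x) ≤ 1)
    (hs : ∀ u ∈ Icc x z, ∀ v ∈ Icc z' y, dist (s u) (s v) ≤ ω (v - u) + ε) :
    dist (α • simpleIntegral P s x z) (β • simpleIntegral P s z' y) ≤
      κ * modulusIntegral ω (z' - z) (y - x) + ε := by
  rw [simpleIntegral_eq_smul_reflect s hxz, simpleIntegral_eq_smul s hzy, smul_smul, smul_smul,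
    ← hαβ, dist_real_smul, abs_of_nonneg (mul_nonneg hα (by linarith)),
    simpleIntegral_eq_weightedSum, simpleIntegral_eq_weightedSum]
  -- Both integrals now carry the mass `α * (z - x)` over `[0, 1]`. The points matched at time `t`
  -- are `L * t + (z' - z)` apart, and `κ` is the mass divided by `L` when `L` is nonzero.
  set L := z - x + (y - z') with hL
  have hL0 : 0 ≤ L := by linarith
  have hcont : ContinuousOn (fun t => ω (L * t + (z' - z))) (Icc 0 1) := by
    refine hω.comp (by fun_prop) fun t ht => ?_
    have := mul_nonneg hL0 ht.1
    simp only [mem_Ici]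
    linarith
  have h1 : ∫ t in Icc (0 : ℝ) 1,
      dist (compAffine s (-(z - x)) z t) (compAffine s (y - z') z' t) ≤
      ∫ t in Icc (0 : ℝ) 1, (ω (L * t + (z' - z)) + ε) := by
    refine setIntegral_mono_on ?_ (hcont.add continuousOn_const).integrableOn_Icc measurableSet_Icc fun t ht => ?_
    · exact integrable_comp_simpleFunc (volume.restrict (Icc (0 : ℝ) 1))
        ((compAffine s (-(z - x)) z).pair (compAffine s (y - z') z')) fun p => dist p.1 p.2
    · have h2 := hs (-(z - x) * t + z) ⟨by nlinarith [ht.1, ht.2], by nlinarith [ht.1, ht.2]⟩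
        ((y - z') * t + z') ⟨by nlinarith [ht.1, ht.2], by nlinarith [ht.1, ht.2]⟩
      have h3 : (y - z') * t + z' - (-(z - x) * t + z) = L * t + (z' - z) := by rw [hL]; ring
      rwa [h3] at h2
  have h4 : ∫ t in Icc (0 : ℝ) 1, (ω (L * t + (z' - z)) + ε) =
      (∫ t in (0 : ℝ)..1, ω (L * t + (z' - z))) + ε := by
    rw [integral_Icc_eq_integral_Ioc, ← intervalIntegral.integral_of_le zero_le_one,
      intervalIntegral.integral_add (hcont.intervalIntegrable_of_Icc zero_le_one)
        intervalIntegrable_const]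
    simp
  have h6 := intervalIntegral.mul_integral_comp_mul_add (a := 0) (b := 1) (f := ω) L (z' - z)
  have h7 : L * 1 + (z' - z) = y - x := by rw [hL]; ring
  rw [h7, mul_zero, zero_add] at h6
  have hm : 0 ≤ α * (z - x) := mul_nonneg hα (by linarith)
  calc α * (z - x) * _ ≤ α * (z - x) * ((∫ t in (0 : ℝ)..1, ω (L * t + (z' - z))) + ε) := by
        refine mul_le_mul_of_nonneg_left ?_ hm
        exact (dist_weightedSum_le hP _ _ _).trans (h1.trans h4.le)
    _ = κ * (L * ∫ t in (0 : ℝ)..1, ω (L * t + (z' - z))) + α * (z - x) * ε := by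
        rw [← hκ]; ring
    _ ≤ _ := by
        rw [h6, modulusIntegral]
        nlinarith

end Transport

end LSpace

namespace LSpace

/-! ### Existence of integrals of continuous mappings. -/

section Existence

/-- Rounds the point, clamped to `[a, b]`, down to a grid of step `δ`. Quantising the argument makes
`f ∘ g` simple for every `f`, and the values stay in `[a, b]` even for arguments outside it. -/
theorem exists_simpleFunc_abs_sub_le {a b δ : ℝ} (hab : a ≤ b) (hδ : 0 < δ) :
    ∃ g : SimpleFunc ℝ ℝ, (∀ t, g t ∈ Icc a b) ∧ ∀ t ∈ Icc a b, |g t - t| ≤ δ := by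
  have hcl : ∀ t : ℝ, max a (min b t) ∈ Icc a b := fun t =>
    ⟨le_max_left _ _, max_le hab (min_le_left _ _)⟩
  let N : ℝ → ℕ := fun t => ⌊(max a (min b t) - a) / δ⌋₊
  have hN : Measurable N := by
    refine Nat.measurable_floor.comp ?_
    fun_prop
  have hle : ∀ t, (N t : ℝ) * δ ≤ max a (min b t) - a := fun t => by
    have h := Nat.floor_le (div_nonneg (sub_nonneg.2 (hcl t).1) hδ.le)
    rwa [le_div_iff₀ hδ] at h
  have hlt : ∀ t, max a (min b t) - a < (N t + 1) * δ := fun t => by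
    have h := Nat.lt_floor_add_one ((max a (min b t) - a) / δ)
    rwa [div_lt_iff₀ hδ] at h
  have hbd : ∀ t, N t ≤ ⌊(b - a) / δ⌋₊ := fun t =>
    Nat.floor_le_floor (by gcongr; exact (hcl t).2)
  have hmeas : Measurable fun t => a + (N t : ℝ) * δ :=
    measurable_const.add ((measurable_from_nat.comp hN).mul_const δ)
  refine ⟨⟨fun t => a + (N t : ℝ) * δ, fun x => hmeas (measurableSet_singleton x), ?_⟩, ?_, ?_⟩
  · refine ((finite_Iic ⌊(b - a) / δ⌋₊).image fun n : ℕ => a + (n : ℝ) * δ).subset ?_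
    rintro _ ⟨t, rfl⟩
    exact ⟨N t, hbd t, rfl⟩
  · intro t
    have h0 : 0 ≤ (N t : ℝ) * δ := by positivity
    change a + (N t : ℝ) * δ ∈ Icc a b
    exact ⟨by linarith, by linarith [hle t, (hcl t).2]⟩
  · intro t ht
    have h : max a (min b t) = t := by rw [min_eq_right ht.2, max_eq_right ht.1]
    have h1 := hle t
    have h2 := hlt t
    rw [h] at h1 h2
    change |a + (N t : ℝ) * δ - t| ≤ δ
    rw [abs_le]
    constructor <;> linarith

theorem exists_simpleFunc_tendstoUniformlyOn {Y : Type*} [PseudoMetricSpace Y] {f : ℝ → Y}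
    {a b : ℝ} (hab : a ≤ b) (hf : ContinuousOn f (Icc a b)) :
    ∃ g : ℕ → SimpleFunc ℝ ℝ, (∀ n t, g n t ∈ Icc a b) ∧
      TendstoUniformlyOn (fun n t => f (g n t)) f atTop (Icc a b) := by
  choose g hg1 hg2 using fun n : ℕ =>
    exists_simpleFunc_abs_sub_le hab (Nat.one_div_pos_of_nat (α := ℝ) (n := n))
  refine ⟨g, hg1, ?_⟩
  rw [Metric.tendstoUniformlyOn_iff]
  intro ε hε
  obtain ⟨δ, hδ, h⟩ := Metric.uniformContinuousOn_iff.1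
    (isCompact_Icc.uniformContinuousOn_of_continuous hf) ε hε
  have h0 := (tendsto_one_div_add_atTop_nhds_zero_nat (𝕜 := ℝ)).eventually (gt_mem_nhds hδ)
  filter_upwards [h0] with n hn t ht
  refine h t ht _ (hg1 n t) ?_
  rw [dist_comm, Real.dist_eq]
  exact (hg2 n t ht).trans_lt hn

variable {X : Type*} [AddCommMonoid X] [MetricSpace X] [LSpace X] {P : X → X}

theorem dist_simpleIntegral_le (hP : IsConvexifying P) (s r : SimpleFunc ℝ X) {a b C : ℝ}
    (hab : a ≤ b) (h : ∀ t ∈ Icc a b, dist (s t) (r t) ≤ C) :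
    dist (simpleIntegral P s a b) (simpleIntegral P r a b) ≤ (b - a) * C := by
  rw [simpleIntegral_eq_weightedSum, simpleIntegral_eq_weightedSum]
  refine (dist_weightedSum_le hP _ s r).trans ?_
  have h1 : ∫ t in Icc a b, dist (s t) (r t) ≤ ∫ _ in Icc a b, C := by
    refine setIntegral_mono_on ?_ (integrable_const C) measurableSet_Icc h
    exact integrable_comp_simpleFunc (volume.restrict (Icc a b)) (s.pair r) fun p => dist p.1 p.2
  refine h1.trans (le_of_eq ?_)
  simp [hab]

theorem isIntegrable_of_continuousOn (hP : IsConvexifying P) {f : ℝ → X} {a b : ℝ} (hab : a ≤ b)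
    (hf : ContinuousOn f (Icc a b)) : IsIntegrable P f a b := by
  -- Taking two sequences at once serves twice: `r = s` gives the Cauchy property, and a different
  -- `r` shows that the limit does not depend on the sequence.
  have key : ∀ s r : ℕ → SimpleFunc ℝ X,
      TendstoUniformlyOn (fun n => ⇑(s n)) f atTop (Icc a b) →
      TendstoUniformlyOn (fun n => ⇑(r n)) f atTop (Icc a b) → ∀ ε > 0, ∃ N, ∀ m ≥ N, ∀ n ≥ N,
      dist (simpleIntegral P (s m) a b) (simpleIntegral P (r n) a b) < ε := by
    intro s r hs hr ε hε
    -- The `+ 1` keeps the denominator positive when `a = b`.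
    set δ := ε / (2 * (b - a + 1)) with hδ
    have hba : 0 < b - a + 1 := by linarith
    have hδ0 : 0 < δ := by positivity
    obtain ⟨N, hN⟩ := eventually_atTop.1
      ((Metric.tendstoUniformlyOn_iff.1 hs δ hδ0).and (Metric.tendstoUniformlyOn_iff.1 hr δ hδ0))
    refine ⟨N, fun m hm n hn => ?_⟩
    refine (dist_simpleIntegral_le hP (s m) (r n) hab (C := 2 * δ) fun t ht => ?_).trans_lt ?_
    · have h1 := (hN m hm).1 t ht
      have h2 := (hN n hn).2 t ht
      rw [dist_comm] at h1
      linarith [dist_triangle (s m t) (f t) (r n t)]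
    · have h3 : (b - a + 1) * (2 * δ) = ε := by rw [hδ]; field_simp
      nlinarith
  obtain ⟨g, -, hg⟩ := exists_simpleFunc_tendstoUniformlyOn hab hf
  have hs : TendstoUniformlyOn (fun n => ⇑((g n).map f)) f atTop (Icc a b) := hg
  have hc : CauchySeq fun n => simpleIntegral P ((g n).map f) a b :=
    Metric.cauchySeq_iff.2 (key _ _ hs hs)
  obtain ⟨J, hJ⟩ := cauchySeq_tendsto_of_complete hc
  refine ⟨J, ⟨_, hs⟩, fun r hr => ?_⟩
  rw [Metric.tendsto_atTop] at hJ ⊢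
  intro ε hε
  obtain ⟨N, hN⟩ := key _ r hs hr (ε / 2) (by positivity)
  obtain ⟨N', hN'⟩ := hJ (ε / 2) (by positivity)
  refine ⟨max N N', fun n hn => ?_⟩
  have h1 := hN n (le_of_max_le_left hn) n (le_of_max_le_left hn)
  have h2 := hN' n (le_of_max_le_right hn)
  rw [dist_comm] at h1
  linarith [dist_triangle (simpleIntegral P (r n) a b) (simpleIntegral P ((g n).map f) a b) J]

theorem IsIntegrable.hasIntegral {f : ℝ → X} {a b : ℝ} (h : IsIntegrable P f a b) :
    HasIntegral P f a b (integral P f a b) := by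
  obtain ⟨J, hJ⟩ := h
  rwa [hJ.integral_eq]

end Existence

section ClassH

theorem continuousOn_of_mem_classH {X : Type*} [MetricSpace X] {ω : ℝ → ℝ}
    (hω : IsModulusOfContinuity ω) {a b : ℝ} {f : ℝ → X} (hf : f ∈ ClassH ω a b X) :
    ContinuousOn f (Icc a b) := by
  intro s hs
  rw [ContinuousWithinAt, tendsto_iff_dist_tendsto_zero]
  have h1 : Tendsto (fun t => ω |t - s|) (𝓝[Icc a b] s) (𝓝 0) := by
    have h2 : ContinuousOn (fun t => ω |t - s|) univ :=
      hω.continuousOn.comp (by fun_prop) fun t _ => mem_Ici.2 (abs_nonneg _)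
    have h3 := ((continuousOn_univ.1 h2).tendsto s).mono_left
      (nhdsWithin_le_nhds (s := Icc a b))
    simpa [hω.map_zero] using h3
  refine squeeze_zero' (Eventually.of_forall fun _ => dist_nonneg) ?_ h1
  filter_upwards [self_mem_nhdsWithin] with t ht
  exact hf t ht s hs

end ClassH

end LSpace

namespace LSpace

/-! ### The upper bounds for simple mappings, case by case. -/

section UpperBound

variable {X : Type*} [AddCommMonoid X] [MetricSpace X] [LSpace X] {P : X → X}

/-- `C` is the mass that stays in place; `A` is carried to `A'` and `B` to `B'`. -/
theorem dist_add_add_le_of_common (A B C A' B' : X) {r r' : ℝ} (h : dist A A' ≤ r)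
    (h' : dist B B' ≤ r') : dist (A + C + B) (C + B' + A') ≤ r + r' := by
  have h1 : A + C + B = A + B + C := add_right_comm _ _ _
  have h2 : C + B' + A' = A' + B' + C := by rw [add_comm, add_comm C B', add_assoc]
  rw [h1, h2]
  exact (dist_add_right_le _ _ _).trans
    ((dist_add_add_le_add _ _ _ _).trans (add_le_add h h'))

theorem dist_simpleMean_le_of_disjoint (hP : IsConvexifying P) {ω : ℝ → ℝ}
    (hω : ContinuousOn ω (Ici 0)) (s : SimpleFunc ℝ X) {a b c d e ε : ℝ} (hab : a < b)
    (hcd : c < d) (hbc : b ≤ c) (hde : d ≤ e) (hε : 0 ≤ ε)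
    (hs : ∀ u ∈ Icc a e, ∀ v ∈ Icc a e, u ≤ v → dist (s u) (s v) ≤ ω (v - u) + ε) :
    dist ((1 / (b - a)) • simpleIntegral P s a b) ((1 / (d - c)) • simpleIntegral P s c d) ≤
      1 / (b - a + (d - c)) * modulusIntegral ω (c - b) (d - a) + ε := by
  have hp : 0 < b - a := by linarith
  have hq : 0 < d - c := by linarith
  refine dist_smul_simpleIntegral_le hP hω s hab.le hbc hcd.le (by positivity) hε ?_ ?_ ?_ ?_
  · field_simp
  · field_simp
  · field_simp; exact le_rfl
  · intro u hu v hv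
    exact hs u ⟨hu.1, by linarith [hu.2]⟩ v ⟨by linarith [hv.1], by linarith [hv.2]⟩
      (by linarith [hu.2, hv.1])

theorem dist_simpleMean_le_of_overlap_ge (hP : IsConvexifying P) {ω : ℝ → ℝ}
    (hω : ContinuousOn ω (Ici 0)) (s : SimpleFunc ℝ X) {a b c d e ε p q : ℝ} (hp : p = b - a)
    (hq : q = d - c) (hq0 : 0 < q) (hpq : q ≤ p) (hcb : c ≤ b) (hbd : b ≤ d) (hde : d ≤ e)
    (hε : 0 ≤ ε)
    (hs : ∀ u ∈ Icc a e, ∀ v ∈ Icc a e, u ≤ v → dist (s u) (s v) ≤ ω (v - u) + ε) :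
    dist ((1 / p) • simpleIntegral P s a b) ((1 / q) • simpleIntegral P s c d) ≤
      1 / (p + q) * modulusIntegral ω (p * (b - c) / q) (d - a) +
        (p - q) / p ^ 2 * modulusIntegral ω 0 (p * (b - c) / q) + 2 * ε := by
  have hp0 : 0 < p := hq0.trans_le hpq
  -- The mass of `[x, c]` at density `1 / p` equals the surplus of `[c, b]` at density `1 / q - 1 /
  -- p`; the rest `[a, x]` is then balanced by `[b, d]`.
  obtain ⟨x, hx⟩ : ∃ x, x = b - p * (b - c) / q := ⟨_, rfl⟩
  have hxq : p * (b - c) = q * (b - x) := by rw [hx]; field_simp; ring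
  have hxq' : p * (b - c) / q = b - x := by rw [hx]; ring
  have hax : a ≤ x := by nlinarith
  have hxc : x ≤ c := by nlinarith
  have h1 : (1 / p) • simpleIntegral P s a b = (1 / p) • simpleIntegral P s a x +
      (1 / p) • simpleIntegral P s c b + (1 / p) • simpleIntegral P s x c := by
    rw [← simpleIntegral_add hP s (hax.trans hxc) hcb, ← simpleIntegral_add hP s hax hxc,
      smul_add, smul_add, add_right_comm]
  have h2 : (1 / q) • simpleIntegral P s c d = (1 / p) • simpleIntegral P s c b +
      (1 / q - 1 / p) • simpleIntegral P s c b + (1 / q) • simpleIntegral P s b d := by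
    have h3 : 0 ≤ 1 / q - 1 / p := sub_nonneg.2 (one_div_le_one_div_of_le hq0 hpq)
    rw [← simpleIntegral_add hP s hcb hbd, smul_add,
      ← isConvexElement_simpleIntegral hP s c b _ _ (by positivity) h3, add_sub_cancel]
  have hs' : ∀ y z z' w : ℝ, a ≤ y → z ≤ z' → w ≤ d →
      ∀ u ∈ Icc y z, ∀ v ∈ Icc z' w, dist (s u) (s v) ≤ ω (v - u) + ε :=
    fun y z z' w h4 h5 h6 u hu v hv =>
      hs u ⟨by linarith [hu.1], by linarith [hu.2, hv.1, hv.2]⟩ v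
        ⟨by linarith [hu.1, hu.2, hv.1], by linarith [hv.2]⟩ (by linarith [hu.2, hv.1])
  have h4 := dist_smul_simpleIntegral_le hP hω s (α := 1 / p) (β := 1 / q) (κ := 1 / (p + q))
    hax (hxc.trans hcb) hbd (by positivity) hε
    (by field_simp; rw [hp, hq] at *; nlinarith) (by field_simp; rw [hp, hq] at *; nlinarith)
    (by rw [one_div_mul_eq_div, div_le_one hp0]; linarith) (hs' _ _ _ _ le_rfl (hxc.trans hcb) le_rfl)
  have h5 := dist_smul_simpleIntegral_le hP hω s (α := 1 / p) (β := 1 / q - 1 / p)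
    (κ := (p - q) / p ^ 2) hxc le_rfl hcb (by positivity) hε
    (by field_simp; nlinarith) (by field_simp; nlinarith)
    (by rw [one_div_mul_eq_div, div_le_one hp0]; linarith) (hs' _ _ _ _ hax le_rfl hbd)
  rw [sub_self] at h5
  rw [h1, h2, hxq']
  refine (dist_add_add_le_of_common _ _ _ _ _ h4 h5).trans (le_of_eq ?_)
  ring

theorem dist_simpleMean_le_of_overlap_le (hP : IsConvexifying P) {ω : ℝ → ℝ}
    (hω : ContinuousOn ω (Ici 0)) (s : SimpleFunc ℝ X) {a b c d e ε p q : ℝ} (hp : p = b - a)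
    (hq : q = d - c) (hp0 : 0 < p) (hpq : p ≤ q) (hac : a ≤ c) (hcb : c ≤ b) (hde : d ≤ e)
    (hε : 0 ≤ ε)
    (hs : ∀ u ∈ Icc a e, ∀ v ∈ Icc a e, u ≤ v → dist (s u) (s v) ≤ ω (v - u) + ε) :
    dist ((1 / p) • simpleIntegral P s a b) ((1 / q) • simpleIntegral P s c d) ≤
      1 / (q + p) * modulusIntegral ω (q * (b - c) / p) (d - a) +
        (q - p) / q ^ 2 * modulusIntegral ω 0 (q * (b - c) / p) + 2 * ε := by
  have hq0 : 0 < q := hp0.trans_le hpq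
  -- Now the first interval is the denser one: its surplus on `[c, b]` fills `[b, x]`, and `[a, c]`
  -- is carried to `[x, d]`.
  obtain ⟨x, hx⟩ : ∃ x, x = c + q * (b - c) / p := ⟨_, rfl⟩
  have hxq : q * (b - c) = p * (x - c) := by rw [hx]; field_simp; ring
  have hxq' : q * (b - c) / p = x - c := by rw [hx]; ring
  have hbx : b ≤ x := by nlinarith
  have hxd : x ≤ d := by nlinarith
  have h1 : (1 / p) • simpleIntegral P s a b = (1 / p) • simpleIntegral P s a c +
      (1 / q) • simpleIntegral P s c b + (1 / p - 1 / q) • simpleIntegral P s c b := by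
    have h3 : 0 ≤ 1 / p - 1 / q := sub_nonneg.2 (one_div_le_one_div_of_le hp0 hpq)
    rw [← simpleIntegral_add hP s hac hcb, smul_add, add_assoc,
      ← isConvexElement_simpleIntegral hP s c b _ _ (by positivity) h3, add_sub_cancel]
  have h2 : (1 / q) • simpleIntegral P s c d = (1 / q) • simpleIntegral P s c b +
      (1 / q) • simpleIntegral P s b x + (1 / q) • simpleIntegral P s x d := by
    rw [← simpleIntegral_add hP s (hcb.trans hbx) hxd, ← simpleIntegral_add hP s hcb hbx,
      smul_add, smul_add]
  have hs' : ∀ y z z' w : ℝ, a ≤ y → z ≤ z' → w ≤ d →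
      ∀ u ∈ Icc y z, ∀ v ∈ Icc z' w, dist (s u) (s v) ≤ ω (v - u) + ε :=
    fun y z z' w h4 h5 h6 u hu v hv =>
      hs u ⟨by linarith [hu.1], by linarith [hu.2, hv.1, hv.2]⟩ v
        ⟨by linarith [hu.1, hu.2, hv.1], by linarith [hv.2]⟩ (by linarith [hu.2, hv.1])
  have h4 := dist_smul_simpleIntegral_le hP hω s (α := 1 / p) (β := 1 / q) (κ := 1 / (q + p))
    hac (hcb.trans hbx) hxd (by positivity) hε
    (by field_simp; rw [hp, hq] at *; nlinarith) (by field_simp; rw [hp, hq] at *; nlinarith)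
    (by rw [one_div_mul_eq_div, div_le_one hp0]; linarith) (hs' _ _ _ _ le_rfl (hcb.trans hbx) le_rfl)
  have h7 : (1 / p - 1 / q) * (b - c) = 1 / q * (x - b) := by field_simp; nlinarith
  have h5 := dist_smul_simpleIntegral_le hP hω s (α := 1 / p - 1 / q) (β := 1 / q)
    (κ := (q - p) / q ^ 2) hcb le_rfl hbx (sub_nonneg.2 (one_div_le_one_div_of_le hp0 hpq)) hε
    h7 (by rw [h7]; field_simp; nlinarith)
    (by rw [h7, one_div_mul_eq_div, div_le_one hq0]; linarith) (hs' _ _ _ _ hac le_rfl hxd)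
  rw [sub_self] at h5
  rw [h1, h2, hxq']
  refine (dist_add_add_le_of_common _ _ _ _ _ h4 h5).trans (le_of_eq ?_)
  ring

theorem dist_simpleMean_le_of_subset (hP : IsConvexifying P) {ω : ℝ → ℝ}
    (hω : ContinuousOn ω (Ici 0)) (s : SimpleFunc ℝ X) {a b c d e ε p q : ℝ} (hp : p = b - a)
    (hq : q = d - c) (hq0 : 0 < q) (hac : a ≤ c) (hdb : d ≤ b) (hbe : b ≤ e)
    (hε : 0 ≤ ε)
    (hs : ∀ u ∈ Icc a e, ∀ v ∈ Icc a e, u ≤ v → dist (s u) (s v) ≤ ω (v - u) + ε) :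
    dist ((1 / p) • simpleIntegral P s a b) ((1 / q) • simpleIntegral P s c d) ≤
      (p - q) / p ^ 2 * (modulusIntegral ω 0 (p * (c - a) / (p - q)) +
        modulusIntegral ω 0 (p * (b - d) / (p - q))) + 2 * ε := by
  rcases eq_or_ne p q with h | hne
  · have h1 : a = c := by linarith
    have h2 : b = d := by linarith
    subst h1 h2 h
    simp [hε]
  have hpq : 0 < p - q := by
    refine lt_of_le_of_ne (by linarith) ?_
    exact (sub_ne_zero.2 hne).symm
  have hp0 : 0 < p := by linarith
  -- The surplus on `[c, d]` is cut at `x` so that `[c, x]` balances `[a, c]` and `[x, d]` balances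
  -- `[d, b]`.
  obtain ⟨x, hx⟩ : ∃ x, x = a + p * (c - a) / (p - q) := ⟨_, rfl⟩
  have hxq : p * (c - a) = (p - q) * (x - a) := by rw [hx]; field_simp; ring
  have hxq' : p * (c - a) / (p - q) = x - a := by rw [hx]; ring
  have hxb : p * (b - d) = (p - q) * (b - x) := by
    have : p * (b - d) = p * (p - q) - p * (c - a) := by rw [hp, hq]; ring
    rw [this, hxq, hp]; ring
  have hxb' : p * (b - d) / (p - q) = b - x := by rw [hxb]; field_simp
  have hcx : c ≤ x := by nlinarith
  have hxd : x ≤ d := by nlinarith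
  have h3 : 0 ≤ 1 / q - 1 / p := sub_nonneg.2 (one_div_le_one_div_of_le hq0 (by linarith))
  have h1 : (1 / p) • simpleIntegral P s a b = (1 / p) • simpleIntegral P s a c +
      (1 / p) • simpleIntegral P s c d + (1 / p) • simpleIntegral P s d b := by
    rw [← simpleIntegral_add hP s (hac.trans (hcx.trans hxd)) hdb,
      ← simpleIntegral_add hP s hac (hcx.trans hxd), smul_add, smul_add]
  have h2 : (1 / q) • simpleIntegral P s c d = (1 / p) • simpleIntegral P s c d +
      (1 / q - 1 / p) • simpleIntegral P s x d + (1 / q - 1 / p) • simpleIntegral P s c x := by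
    rw [add_assoc, ← smul_add, add_comm (simpleIntegral P s x d), simpleIntegral_add hP s hcx hxd,
      ← isConvexElement_simpleIntegral hP s c d _ _ (by positivity) h3, add_sub_cancel]
  have hs' : ∀ y z z' w : ℝ, a ≤ y → z ≤ z' → w ≤ b →
      ∀ u ∈ Icc y z, ∀ v ∈ Icc z' w, dist (s u) (s v) ≤ ω (v - u) + ε :=
    fun y z z' w h4 h5 h6 u hu v hv =>
      hs u ⟨by linarith [hu.1], by linarith [hu.2, hv.1, hv.2]⟩ v
        ⟨by linarith [hu.1, hu.2, hv.1], by linarith [hv.2]⟩ (by linarith [hu.2, hv.1])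
  have h4 := dist_smul_simpleIntegral_le hP hω s (α := 1 / p) (β := 1 / q - 1 / p)
    (κ := (p - q) / p ^ 2) hac le_rfl hcx (by positivity) hε
    (by field_simp; nlinarith) (by field_simp; nlinarith)
    (by rw [one_div_mul_eq_div, div_le_one hp0]; linarith)
    (hs' _ _ _ _ le_rfl le_rfl (hxd.trans hdb))
  have h7 : (1 / q - 1 / p) * (d - x) = 1 / p * (b - d) := by field_simp; nlinarith
  have h5 := dist_smul_simpleIntegral_le hP hω s (α := 1 / q - 1 / p) (β := 1 / p)
    (κ := (p - q) / p ^ 2) hxd le_rfl hdb h3 hε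
    h7 (by rw [h7]; field_simp; nlinarith)
    (by rw [h7, one_div_mul_eq_div, div_le_one hp0]; linarith)
    (hs' _ _ _ _ (hac.trans hcx) le_rfl le_rfl)
  rw [sub_self] at h4 h5
  rw [dist_comm] at h5
  rw [h1, h2, hxq', hxb']
  refine (dist_add_add_le_of_common _ _ _ _ _ h4 h5).trans (le_of_eq ?_)
  ring

end UpperBound

end LSpace

/-! ### Concave moduli and real functions with a given modulus. -/

section Concave

variable {ω : ℝ → ℝ}

theorem ConcaveOn.mul_map_div_add_le (hc : ConcaveOn ℝ (Ici 0) ω) (hω : IsModulusOfContinuity ω)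
    {l x y : ℝ} (hl : l ∈ Icc (0 : ℝ) 1) (hx : 0 ≤ x) (hy : 0 ≤ y) :
    l * ω (x / l) + (1 - l) * ω (y / (1 - l)) ≤ ω (x + y) := by
  rcases hl.1.eq_or_lt with rfl | h0
  · simpa using hω.monotoneOn (mem_Ici.2 hy) (mem_Ici.2 (by linarith)) (by linarith)
  rcases hl.2.eq_or_lt with rfl | h1
  · simpa using hω.monotoneOn (mem_Ici.2 hx) (mem_Ici.2 (by linarith)) (by linarith)
  have h1' : 0 < 1 - l := by linarith
  have h := hc.2 (x := x / l) (y := y / (1 - l)) (mem_Ici.2 (by positivity))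
    (mem_Ici.2 (by positivity)) h0.le h1'.le (by ring)
  simp only [smul_eq_mul] at h
  rwa [mul_div_cancel₀ _ h0.ne', mul_div_cancel₀ _ h1'.ne'] at h

theorem ConcaveOn.mul_map_div_le (hc : ConcaveOn ℝ (Ici 0) ω) (hω : IsModulusOfContinuity ω)
    {l x : ℝ} (hl : l ∈ Icc (0 : ℝ) 1) (hx : 0 ≤ x) : l * ω (x / l) ≤ ω x := by
  simpa [hω.map_zero] using hc.mul_map_div_add_le hω hl hx le_rfl

/-- Both `y` and `x + δ` are convex combinations of `x` and `y + δ` with the weights exchanged;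
adding the two concavity inequalities gives the claim. -/
theorem ConcaveOn.map_add_sub_le (hc : ConcaveOn ℝ (Ici 0) ω) {x y δ : ℝ} (hx : 0 ≤ x)
    (hxy : x ≤ y) (hδ : 0 ≤ δ) : ω (y + δ) - ω y ≤ ω (x + δ) - ω x := by
  rcases hxy.eq_or_lt with rfl | hlt
  · exact le_rfl
  set θ := δ / (y - x + δ) with hθ
  have hpos : 0 < y - x + δ := by linarith
  have h0 : 0 ≤ θ := by positivity
  have h1 : 0 ≤ 1 - θ := by
    rw [sub_nonneg, hθ, div_le_one hpos]
    linarith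
  have hθ' : θ * (y - x + δ) = δ := by rw [hθ]; field_simp
  have hx' : x ∈ Ici (0 : ℝ) := hx
  have hy' : y + δ ∈ Ici (0 : ℝ) := mem_Ici.2 (by linarith)
  have h2 := hc.2 hx' hy' h0 h1 (by ring)
  have h3 := hc.2 hx' hy' h1 h0 (by ring)
  simp only [smul_eq_mul] at h2 h3
  have e2 : θ * x + (1 - θ) * (y + δ) = y := by linarith
  have e3 : (1 - θ) * x + θ * (y + δ) = x + δ := by linarith
  rw [e2] at h2
  rw [e3] at h3
  linarith

end Concave

/-- The real functions on the line which admit `ω` as a modulus of continuity. -/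
def HasModulus (ω φ : ℝ → ℝ) : Prop := ∀ s t, s ≤ t → |φ t - φ s| ≤ ω (t - s)

namespace HasModulus

variable {ω φ ψ : ℝ → ℝ}

theorem mem_classH (h : HasModulus ω φ) (a b : ℝ) : φ ∈ ClassH ω a b ℝ := by
  intro s _ t _
  rw [Real.dist_eq]
  rcases le_total s t with hst | hst
  · rw [abs_sub_comm, abs_sub_comm s t, abs_of_nonneg (sub_nonneg.2 hst)]
    exact h s t hst
  · rw [abs_of_nonneg (sub_nonneg.2 hst)]
    exact h t s hst

theorem continuous (h : HasModulus ω φ) (hω : IsModulusOfContinuity ω) : Continuous φ :=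
  continuous_iff_continuousAt.2 fun t =>
    (LSpace.continuousOn_of_mem_classH hω (h.mem_classH (t - 1) (t + 1))).continuousAt
      (Icc_mem_nhds (by linarith) (by linarith))

theorem sub_const (h : HasModulus ω φ) (C : ℝ) : HasModulus ω fun t => φ t - C := by
  intro s t hst
  simpa using h s t hst

theorem min (h : HasModulus ω φ) (h' : HasModulus ω ψ) :
    HasModulus ω fun t => Min.min (φ t) (ψ t) := fun s t hst =>
  (abs_min_sub_min_le_max _ _ _ _).trans (max_le (h s t hst) (h' s t hst))

theorem neg (h : HasModulus ω φ) : HasModulus ω fun t => -φ t := by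
  intro s t hst
  rw [neg_sub_neg, abs_sub_comm]
  exact h s t hst

end HasModulus

/-- The function whose increment from `z - (1 - l) * r` to `z + l * r` is `ω r`. -/
noncomputable def kink (ω : ℝ → ℝ) (l z t : ℝ) : ℝ :=
  l * ω (max (t - z) 0 / l) - (1 - l) * ω (max (z - t) 0 / (1 - l))

/-! ### Kinks and their gluing. -/

section Kink

variable {ω : ℝ → ℝ} {l : ℝ}

theorem kink_of_ge (hω : IsModulusOfContinuity ω) {z t : ℝ} (h : z ≤ t) :
    kink ω l z t = l * ω ((t - z) / l) := by
  rw [kink, max_eq_left (by linarith), max_eq_right (by linarith), zero_div, hω.map_zero]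
  ring

theorem kink_of_le (hω : IsModulusOfContinuity ω) {z t : ℝ} (h : t ≤ z) :
    kink ω l z t = -((1 - l) * ω ((z - t) / (1 - l))) := by
  rw [kink, max_eq_right (by linarith), max_eq_left (by linarith), zero_div, hω.map_zero]
  ring

theorem kink_sub_kink (hω : IsModulusOfContinuity ω) (hl : l ∈ Icc (0 : ℝ) 1) (z : ℝ) {r : ℝ}
    (hr : 0 ≤ r) : kink ω l z (z + l * r) - kink ω l z (z - (1 - l) * r) = ω r := by
  have h0 : 0 ≤ l * r := mul_nonneg hl.1 hr
  have h1 : 0 ≤ (1 - l) * r := mul_nonneg (by linarith [hl.2]) hr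
  rw [kink_of_ge hω (by linarith), kink_of_le hω (by linarith), add_sub_cancel_left,
    sub_sub_cancel]
  rcases eq_or_ne l 0 with rfl | hl0
  · simp
  rcases eq_or_ne (1 - l) 0 with hl1 | hl1
  · have : l = 1 := by linarith
    subst this
    simp
  · rw [mul_div_cancel_left₀ _ hl0, mul_div_cancel_left₀ _ hl1]
    ring

theorem monotone_kink (hω : IsModulusOfContinuity ω) (hl : l ∈ Icc (0 : ℝ) 1) (z : ℝ) :
    Monotone (kink ω l z) := by
  intro s t hst
  have hl0 := hl.1
  have hl1 : 0 ≤ 1 - l := by linarith [hl.2]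
  refine sub_le_sub (mul_le_mul_of_nonneg_left ?_ hl0) (mul_le_mul_of_nonneg_left ?_ hl1)
  · refine hω.monotoneOn (mem_Ici.2 (by positivity)) (mem_Ici.2 (by positivity)) ?_
    gcongr
  · refine hω.monotoneOn (mem_Ici.2 (by positivity)) (mem_Ici.2 (by positivity)) ?_
    gcongr

/-- Subadditivity bounds the increment by `l * ω ((y - x) / l)`, and concavity with `ω 0 = 0` bounds
that by `ω (y - x)`. -/
theorem mul_map_div_sub_le (hω : IsModulusOfContinuity ω) (hc : ConcaveOn ℝ (Ici 0) ω)
    (hl : l ∈ Icc (0 : ℝ) 1) {x y : ℝ} (hx : 0 ≤ x) (hxy : x ≤ y) :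
    l * ω (y / l) - l * ω (x / l) ≤ ω (y - x) := by
  have hl0 := hl.1
  have h1 := hω.subadditive (x / l) ((y - x) / l) (by positivity)
    (div_nonneg (by linarith) hl0)
  rw [← add_div, add_sub_cancel] at h1
  have h2 := hc.mul_map_div_le hω hl (x := y - x) (by linarith)
  nlinarith

/-- On one side of `z` this is the scaled increment bound; across `z` it is Jensen's inequality with
weights `l` and `1 - l`. -/
theorem hasModulus_kink (hω : IsModulusOfContinuity ω) (hc : ConcaveOn ℝ (Ici 0) ω)
    (hl : l ∈ Icc (0 : ℝ) 1) (z : ℝ) : HasModulus ω (kink ω l z) := by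
  intro s t hst
  rw [abs_of_nonneg (sub_nonneg.2 (monotone_kink hω hl z hst))]
  have hl' : 1 - l ∈ Icc (0 : ℝ) 1 := ⟨by linarith [hl.2], by linarith [hl.1]⟩
  rcases le_total z s with hs | hs
  · rw [kink_of_ge hω hs, kink_of_ge hω (hs.trans hst)]
    have h := mul_map_div_sub_le hω hc hl (x := s - z) (y := t - z) (by linarith) (by linarith)
    rwa [sub_sub_sub_cancel_right] at h
  rcases le_total t z with ht | ht
  · rw [kink_of_le hω ht, kink_of_le hω hs]
    have h := mul_map_div_sub_le hω hc hl' (x := z - t) (y := z - s) (by linarith) (by linarith)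
    rw [sub_sub_sub_cancel_left] at h
    linarith
  · rw [kink_of_ge hω ht, kink_of_le hω hs, sub_neg_eq_add]
    have h := hc.mul_map_div_add_le hω hl (x := t - z) (y := z - s) (by linarith) (by linarith)
    rwa [sub_add_sub_cancel] at h

/-- Gluing of two increasing functions: `F` is used on `[A, B]`, and `G` outside. -/
theorem HasModulus.glue (hc : ConcaveOn ℝ (Ici 0) ω)
    {F G : ℝ → ℝ} (hF : HasModulus ω F) (hG : HasModulus ω G) (hFm : Monotone F) (hGm : Monotone G)
    {A B : ℝ} (hAB : A ≤ B) (hFAB : F B - F A = ω (B - A)) (hGAB : G B - G A = ω (B - A)) :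
    HasModulus ω fun t => F (max A (Min.min B t)) + G t - G (max A (Min.min B t)) := by
  have key : ∀ s t, s ≤ t → G t - G s ≤ ω (t - s) := fun s t hst =>
    (le_abs_self _).trans (hG s t hst)
  have key' : ∀ s t, s ≤ t → F t - F s ≤ ω (t - s) := fun s t hst =>
    (le_abs_self _).trans (hF s t hst)
  have lo : ∀ t, t ≤ A → max A (Min.min B t) = A := fun t h => max_eq_left ((min_le_right _ _).trans h)
  have hi : ∀ t, B ≤ t → max A (Min.min B t) = B := fun t h => by
    rw [min_eq_left h, max_eq_right hAB]
  have mid : ∀ t, A ≤ t → t ≤ B → max A (Min.min B t) = t := fun t h h' => by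
    rw [min_eq_right h', max_eq_right h]
  intro s t hst
  rw [abs_le]
  rcases le_total t A with htA | htA
  · simp only [lo t htA, lo s (hst.trans htA)]
    constructor <;> linarith [key s t hst, hGm hst, key' s t hst, hFm hst]
  rcases le_total B s with hsB | hsB
  · simp only [hi s hsB, hi t (hsB.trans hst)]
    constructor <;> linarith [key s t hst, hGm hst, key' s t hst, hFm hst]
  rcases le_total s A with hsA | hsA <;> rcases le_total t B with htB | htB
  -- Since `G` gains all of `ω (B - A)` on `[A, B]`, its gain on `[s, A]` is at most `ω (B - s) - ω
  -- (B - A)`. By concavity this is at most `ω (t - s) - ω (t - A)`, which leaves room for the gain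
  -- of `F` on `[A, t]`.
  · simp only [lo s hsA, mid t htA htB]
    have h1 := hGm hsA
    have h2 := hFm htA
    have h3 := key s B (hsA.trans hAB)
    have h4 := key' A t htA
    have h5 := hc.map_add_sub_le (x := t - A) (y := B - A) (δ := A - s) (by linarith)
      (by linarith) (by linarith)
    have e1 : B - A + (A - s) = B - s := by ring
    have e2 : t - A + (A - s) = t - s := by ring
    rw [e1, e2] at h5
    constructor <;> linarith
  · simp only [lo s hsA, hi t htB]
    constructor <;> linarith [key s t hst, hGm hst]
  · simp only [mid s hsA hsB, mid t htA htB]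
    constructor <;> linarith [key' s t hst, hFm hst]
  · simp only [mid s hsA hsB, hi t htB]
    have h1 := hGm htB
    have h2 := hFm hsB
    have h3 := key A t htA
    have h4 := key' s B hsB
    have h5 := hc.map_add_sub_le (x := B - s) (y := B - A) (δ := t - B) (by linarith)
      (by linarith) (by linarith)
    have e1 : B - A + (t - B) = t - A := by ring
    have e2 : B - s + (t - B) = t - s := by ring
    rw [e1, e2] at h5
    constructor <;> linarith

end Kink

/-! ### Equality in the transport estimate. -/

section Pairing

variable {ω φ : ℝ → ℝ}

theorem mul_integral_sub_mul_integral_eq (hφ : Continuous φ) {x z z' y α β κ : ℝ}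
    (hαβ : α * (z - x) = β * (y - z')) (hκ : κ * (z - x + (y - z')) = α * (z - x))
    (h : ∀ t ∈ Icc (0 : ℝ) 1, φ ((y - z') * t + z') - φ (-(z - x) * t + z) =
      ω ((z - x + (y - z')) * t + (z' - z))) :
    (β * ∫ t in z'..y, φ t) - α * ∫ t in x..z, φ t = κ * modulusIntegral ω (z' - z) (y - x) := by
  have h1 := intervalIntegral.mul_integral_comp_mul_add (a := 0) (b := 1) (f := φ) (y - z') z'
  have h2 := intervalIntegral.mul_integral_comp_mul_add (a := 0) (b := 1) (f := φ) (-(z - x)) z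
  have h3 := intervalIntegral.mul_integral_comp_mul_add (a := 0) (b := 1) (f := ω)
    (z - x + (y - z')) (z' - z)
  have e1 : (y - z') * 1 + z' = y := by ring
  have e2 : -(z - x) * 1 + z = x := by ring
  have e3 : (z - x + (y - z')) * 1 + (z' - z) = y - x := by ring
  rw [e1, mul_zero, zero_add] at h1
  rw [e2, mul_zero, zero_add, intervalIntegral.integral_symm x z] at h2
  rw [e3, mul_zero, zero_add] at h3
  have h4 : ∫ t in (0 : ℝ)..1, ω ((z - x + (y - z')) * t + (z' - z)) =
      (∫ t in (0 : ℝ)..1, φ ((y - z') * t + z')) - ∫ t in (0 : ℝ)..1, φ (-(z - x) * t + z) := by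
    rw [← intervalIntegral.integral_sub]
    · refine intervalIntegral.integral_congr fun t ht => (h t ?_).symm
      rwa [uIcc_of_le zero_le_one] at ht
    · exact (hφ.comp (by fun_prop)).intervalIntegrable _ _
    · exact (hφ.comp (by fun_prop)).intervalIntegrable _ _
  rw [modulusIntegral, ← h3, ← mul_assoc, hκ, h4, ← h1]
  have h5 : ∫ t in x..z, φ t = (z - x) * ∫ t in (0 : ℝ)..1, φ (-(z - x) * t + z) := by linarith
  rw [h5, ← mul_assoc, ← mul_assoc, ← hαβ]
  ring

/-- The pairing identity for a function which coincides with `kink ω l ζ` up to a constant. -/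
theorem mul_integral_sub_mul_integral_eq_of_kink (hω : IsModulusOfContinuity ω) (hφ : Continuous φ)
    {x z z' y α β κ l ζ C : ℝ} (hxz : x ≤ z) (hzz : z ≤ z') (hzy : z' ≤ y)
    (hl : l ∈ Icc (0 : ℝ) 1) (hζ : z' - ζ = l * (z' - z)) (hly : y - z' = l * (z - x + (y - z')))
    (hαβ : α * (z - x) = β * (y - z')) (hκ : κ * (z - x + (y - z')) = α * (z - x))
    (hl1 : ∀ t ∈ Icc x z, φ t = kink ω l ζ t - C) (hl2 : ∀ t ∈ Icc z' y, φ t = kink ω l ζ t - C) :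
    (β * ∫ t in z'..y, φ t) - α * ∫ t in x..z, φ t = κ * modulusIntegral ω (z' - z) (y - x) := by
  refine mul_integral_sub_mul_integral_eq hφ hαβ hκ fun t ht => ?_
  rw [hl2 _ ⟨by nlinarith [ht.1, ht.2], by nlinarith [ht.1, ht.2]⟩,
    hl1 _ ⟨by nlinarith [ht.1, ht.2], by nlinarith [ht.1, ht.2]⟩, sub_sub_sub_cancel_right]
  have hr : 0 ≤ (z - x + (y - z')) * t + (z' - z) := by
    have := mul_nonneg (add_nonneg (sub_nonneg.2 hxz) (sub_nonneg.2 hzy)) ht.1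
    linarith
  rw [← kink_sub_kink hω hl ζ hr]
  -- With `r` the distance of the matched points, they are `ζ + l * r` and `ζ - (1 - l) * r`,
  -- exactly where the kink gains `ω r`.
  have e1 : (y - z') * t + z' = ζ + l * ((z - x + (y - z')) * t + (z' - z)) := by
    linear_combination t * hly + hζ
  have e2 : -(z - x) * t + z = ζ - (1 - l) * ((z - x + (y - z')) * t + (z' - z)) := by
    linear_combination t * hly + hζ
  rw [e1, e2]

end Pairing

/-! ### Real extremal functions. -/

section Extremal

variable {ω : ℝ → ℝ}

theorem exists_extremal_of_disjoint (hω : IsModulusOfContinuity ω) (hc : ConcaveOn ℝ (Ici 0) ω)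
    {a b c d p q : ℝ} (hp : p = b - a) (hq : q = d - c) (hp0 : 0 < p) (hq0 : 0 < q) (hbc : b ≤ c) :
    ∃ φ : ℝ → ℝ, HasModulus ω φ ∧ ((1 / q) * ∫ t in c..d, φ t) - (1 / p) * ∫ t in a..b, φ t =
      1 / (p + q) * modulusIntegral ω (c - b) (d - a) := by
  have hl : q / (p + q) ∈ Icc (0 : ℝ) 1 :=
    ⟨by positivity, by rw [div_le_one (by positivity)]; linarith⟩
  have hmod := hasModulus_kink hω hc hl (c - q / (p + q) * (c - b))
  refine ⟨_, hmod, mul_integral_sub_mul_integral_eq_of_kink (C := 0)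
    (l := q / (p + q)) (ζ := c - q / (p + q) * (c - b)) hω (hmod.continuous hω) (by linarith) hbc
    (by linarith) hl (by ring) ?_ ?_ ?_ (fun _ _ => (sub_zero _).symm)
    fun _ _ => (sub_zero _).symm⟩
  · rw [← hp, ← hq]; field_simp
  · rw [← hp, ← hq]; field_simp
  · rw [← hp, ← hq]; field_simp

/-- The conditions on `ζ` and `ζ'` make `A`, `B` a matched pair of both kinks, so both gain `ω (B -
A)` and a single constant `C` serves on both outer sides. The `- 0` matches the shape required by
`mul_integral_sub_mul_integral_eq_of_kink`. -/
theorem exists_hasModulus_glue (hω : IsModulusOfContinuity ω) (hc : ConcaveOn ℝ (Ici 0) ω)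
    {l l' A B ζ ζ' : ℝ} (hl : l ∈ Icc (0 : ℝ) 1) (hl' : l' ∈ Icc (0 : ℝ) 1) (hAB : A ≤ B)
    (hζ : B - ζ = l * (B - A)) (hζ' : B - ζ' = l' * (B - A)) :
    ∃ φ : ℝ → ℝ, HasModulus ω φ ∧ (∀ t ∈ Icc A B, φ t = kink ω l ζ t - 0) ∧
      ∃ C, ∀ t, t ≤ A ∨ B ≤ t → φ t = kink ω l' ζ' t - C := by
  have key : ∀ l ζ, l ∈ Icc (0 : ℝ) 1 → B - ζ = l * (B - A) →
      kink ω l ζ B - kink ω l ζ A = ω (B - A) := by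
    intro l ζ hl hζ
    rw [← kink_sub_kink hω hl ζ (sub_nonneg.2 hAB)]
    congr 2 <;> linarith
  have h1 := key l ζ hl hζ
  have h2 := key l' ζ' hl' hζ'
  refine ⟨_, HasModulus.glue hc (hasModulus_kink hω hc hl ζ) (hasModulus_kink hω hc hl' ζ')
    (monotone_kink hω hl ζ) (monotone_kink hω hl' ζ') hAB h1 h2, fun t ht => ?_,
    kink ω l' ζ' A - kink ω l ζ A, fun t ht => ?_⟩
  · simp only [min_eq_right ht.2, max_eq_right ht.1]
    ring
  · rcases ht with ht | ht
    · simp only [max_eq_left ((min_le_right B t).trans ht)]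
      ring
    · simp only [min_eq_left ht, max_eq_right hAB]
      linarith

theorem exists_extremal_of_overlap_ge (hω : IsModulusOfContinuity ω)
    (hc : ConcaveOn ℝ (Ici 0) ω) {a b c d p q : ℝ} (hp : p = b - a) (hq : q = d - c)
    (hq0 : 0 < q) (hpq : q ≤ p) (hcb : c ≤ b) (hbd : b ≤ d) :
    ∃ φ : ℝ → ℝ, HasModulus ω φ ∧ ((1 / q) * ∫ t in c..d, φ t) - (1 / p) * ∫ t in a..b, φ t =
      1 / (p + q) * modulusIntegral ω (p * (b - c) / q) (d - a) +
        (p - q) / p ^ 2 * modulusIntegral ω 0 (p * (b - c) / q) := by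
  have hp0 : 0 < p := hq0.trans_le hpq
  obtain ⟨x, hx⟩ : ∃ x, x = b - p * (b - c) / q := ⟨_, rfl⟩
  have hxq : p * (b - c) = q * (b - x) := by rw [hx]; field_simp; ring
  have hxq' : p * (b - c) / q = b - x := by rw [hx]; ring
  have hax : a ≤ x := by nlinarith
  have hxc : x ≤ c := by nlinarith
  have hl : q / p ∈ Icc (0 : ℝ) 1 := ⟨by positivity, by rwa [div_le_one hp0]⟩
  have hl' : q / (p + q) ∈ Icc (0 : ℝ) 1 :=
    ⟨by positivity, by rw [div_le_one (by positivity)]; linarith⟩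
  have hbc : b - c = q / p * (b - x) := by field_simp; linarith
  -- The inner kink serves the pairing of `[x, c]` with `[c, b]`; the outer one serves that of `[a,
  -- x]` with `[b, d]`, all of whose pairs straddle `[x, b]`.
  obtain ⟨φ, hφ, hin, C, hout⟩ := exists_hasModulus_glue hω hc (ζ := c)
    (ζ' := b - q / (p + q) * (b - x)) hl hl' (hxc.trans hcb) hbc (by ring)
  have hcont := hφ.continuous hω
  have h1 := mul_integral_sub_mul_integral_eq_of_kink (α := 1 / p) (β := 1 / q)
    (κ := 1 / (p + q)) hω hcont hax (hxc.trans hcb) hbd hl' (by ring)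
    (by field_simp; rw [hp, hq] at *; nlinarith) (by field_simp; rw [hp, hq] at *; nlinarith)
    (by field_simp; rw [hp, hq] at *; nlinarith)
    (fun t ht => hout t (Or.inl ht.2)) fun t ht => hout t (Or.inr ht.1)
  have h2 := mul_integral_sub_mul_integral_eq_of_kink (α := 1 / p) (β := 1 / q - 1 / p)
    (κ := (p - q) / p ^ 2) hω hcont hxc le_rfl hcb hl (by ring)
    (by linear_combination hbc) (by field_simp; nlinarith) (by field_simp; nlinarith)
    (fun t ht => hin t ⟨ht.1, ht.2.trans hcb⟩) fun t ht => hin t ⟨hxc.trans ht.1, ht.2⟩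
  have hi : ∀ u v : ℝ, IntervalIntegrable φ volume u v := fun u v => hcont.intervalIntegrable u v
  have e1 := intervalIntegral.integral_add_adjacent_intervals (hi a x) (hi x c)
  have e2 := intervalIntegral.integral_add_adjacent_intervals (hi a c) (hi c b)
  have e3 := intervalIntegral.integral_add_adjacent_intervals (hi c b) (hi b d)
  refine ⟨φ, hφ, ?_⟩
  rw [sub_self] at h2
  rw [hxq', ← h1, ← h2, ← e3, ← e2, ← e1]
  ring

theorem exists_extremal_of_overlap_le (hω : IsModulusOfContinuity ω)
    (hc : ConcaveOn ℝ (Ici 0) ω) {a b c d p q : ℝ} (hp : p = b - a) (hq : q = d - c)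
    (hp0 : 0 < p) (hpq : p ≤ q) (hac : a ≤ c) (hcb : c ≤ b) :
    ∃ φ : ℝ → ℝ, HasModulus ω φ ∧ ((1 / q) * ∫ t in c..d, φ t) - (1 / p) * ∫ t in a..b, φ t =
      1 / (q + p) * modulusIntegral ω (q * (b - c) / p) (d - a) +
        (q - p) / q ^ 2 * modulusIntegral ω 0 (q * (b - c) / p) := by
  have hq0 : 0 < q := hp0.trans_le hpq
  obtain ⟨x, hx⟩ : ∃ x, x = c + q * (b - c) / p := ⟨_, rfl⟩
  have hxq : q * (b - c) = p * (x - c) := by rw [hx]; field_simp; ring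
  have hxq' : q * (b - c) / p = x - c := by rw [hx]; ring
  have hbx : b ≤ x := by nlinarith
  have hxd : x ≤ d := by nlinarith
  have hl : (q - p) / q ∈ Icc (0 : ℝ) 1 :=
    ⟨div_nonneg (by linarith) hq0.le, by rw [div_le_one hq0]; linarith⟩
  have hl' : q / (q + p) ∈ Icc (0 : ℝ) 1 :=
    ⟨by positivity, by rw [div_le_one (by positivity)]; linarith⟩
  have hxb : x - b = (q - p) / q * (x - c) := by field_simp; linarith
  obtain ⟨φ, hφ, hin, C, hout⟩ := exists_hasModulus_glue hω hc (ζ := b)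
    (ζ' := x - q / (q + p) * (x - c)) hl hl' (hcb.trans hbx) hxb (by ring)
  have hcont := hφ.continuous hω
  have h1 := mul_integral_sub_mul_integral_eq_of_kink (α := 1 / p) (β := 1 / q)
    (κ := 1 / (q + p)) hω hcont hac (hcb.trans hbx) hxd hl' (by ring)
    (by field_simp; rw [hp, hq] at *; nlinarith) (by field_simp; rw [hp, hq] at *; nlinarith)
    (by field_simp; rw [hp, hq] at *; nlinarith)
    (fun t ht => hout t (Or.inl ht.2)) fun t ht => hout t (Or.inr ht.1)
  have h7 : (1 / p - 1 / q) * (b - c) = 1 / q * (x - b) := by field_simp; nlinarith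
  have h2 := mul_integral_sub_mul_integral_eq_of_kink (α := 1 / p - 1 / q) (β := 1 / q)
    (κ := (q - p) / q ^ 2) hω hcont hcb le_rfl hbx hl (by ring)
    (by linear_combination hxb) h7 (by rw [h7]; field_simp; nlinarith)
    (fun t ht => hin t ⟨ht.1, ht.2.trans hbx⟩) fun t ht => hin t ⟨hcb.trans ht.1, ht.2⟩
  have hi : ∀ u v : ℝ, IntervalIntegrable φ volume u v := fun u v => hcont.intervalIntegrable u v
  have e1 := intervalIntegral.integral_add_adjacent_intervals (hi c b) (hi b x)
  have e2 := intervalIntegral.integral_add_adjacent_intervals (hi c x) (hi x d)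
  have e3 := intervalIntegral.integral_add_adjacent_intervals (hi a c) (hi c b)
  refine ⟨φ, hφ, ?_⟩
  rw [sub_self] at h2
  rw [hxq', ← h1, ← h2, ← e3, ← e2, ← e1]
  ring

theorem exists_extremal_of_subset (hω : IsModulusOfContinuity ω)
    (hc : ConcaveOn ℝ (Ici 0) ω) {a b c d p q : ℝ} (hp : p = b - a) (hq : q = d - c)
    (hq0 : 0 < q) (hac : a ≤ c) (hdb : d ≤ b) :
    ∃ φ : ℝ → ℝ, HasModulus ω φ ∧ ((1 / q) * ∫ t in c..d, φ t) - (1 / p) * ∫ t in a..b, φ t =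
      (p - q) / p ^ 2 * (modulusIntegral ω 0 (p * (c - a) / (p - q)) +
        modulusIntegral ω 0 (p * (b - d) / (p - q))) := by
  rcases eq_or_ne p q with h | hne
  · have h1 : a = c := by linarith
    have h2 : b = d := by linarith
    subst h1 h2 h
    exact ⟨_, hasModulus_kink hω hc (l := 0) (by simp) 0, by simp⟩
  have hpq : 0 < p - q := lt_of_le_of_ne (by linarith) (sub_ne_zero.2 hne).symm
  have hp0 : 0 < p := by linarith
  obtain ⟨x, hx⟩ : ∃ x, x = a + p * (c - a) / (p - q) := ⟨_, rfl⟩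
  have hxq : p * (c - a) = (p - q) * (x - a) := by rw [hx]; field_simp; ring
  have hxq' : p * (c - a) / (p - q) = x - a := by rw [hx]; ring
  have hxb : p * (b - d) = (p - q) * (b - x) := by
    have : p * (b - d) = p * (p - q) - p * (c - a) := by rw [hp, hq]; ring
    rw [this, hxq, hp]; ring
  have hxb' : p * (b - d) / (p - q) = b - x := by rw [hxb]; field_simp
  have hcx : c ≤ x := by nlinarith
  have hxd : x ≤ d := by nlinarith
  have hl : q / p ∈ Icc (0 : ℝ) 1 := ⟨by positivity, by rw [div_le_one hp0]; linarith⟩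
  have hl' : (p - q) / p ∈ Icc (0 : ℝ) 1 :=
    ⟨by positivity, by rw [div_le_one hp0]; linarith⟩
  have hF := hasModulus_kink hω hc hl c
  have hG := hasModulus_kink hω hc hl' d
  have hFm := monotone_kink hω hl c
  have hGm := monotone_kink hω hl' d
  -- A peak at `x`: the rising kink is the smaller function to the left of `x` and the falling one
  -- to the right, since both vanish at `x`.
  have hφ := (hF.sub_const (kink ω (q / p) c x)).min
    (hG.neg.sub_const (-kink ω ((p - q) / p) d x))
  have hcont := hφ.continuous hω
  have hlow : ∀ t, t ≤ x → min (kink ω (q / p) c t - kink ω (q / p) c x)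
      (-kink ω ((p - q) / p) d t - -kink ω ((p - q) / p) d x) =
      kink ω (q / p) c t - kink ω (q / p) c x := fun t ht =>
    min_eq_left (by linarith [hFm ht, hGm ht])
  have hhigh : ∀ t, x ≤ t → -min (kink ω (q / p) c t - kink ω (q / p) c x)
      (-kink ω ((p - q) / p) d t - -kink ω ((p - q) / p) d x) =
      kink ω ((p - q) / p) d t - kink ω ((p - q) / p) d x := fun t ht => by
    rw [min_eq_right (by linarith [hFm ht, hGm ht])]
    ring
  refine ⟨_, hφ, ?_⟩
  set φ : ℝ → ℝ := fun t => min (kink ω (q / p) c t - kink ω (q / p) c x)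
      (-kink ω ((p - q) / p) d t - -kink ω ((p - q) / p) d x)
  have h1 := mul_integral_sub_mul_integral_eq_of_kink (α := 1 / p) (β := 1 / q - 1 / p)
    (κ := (p - q) / p ^ 2) hω hcont hac le_rfl hcx hl (by ring)
    (by field_simp; nlinarith) (by field_simp; nlinarith) (by field_simp; nlinarith)
    (fun t ht => hlow t (ht.2.trans hcx)) fun t ht => hlow t ht.2
  have h7 : (1 / q - 1 / p) * (d - x) = 1 / p * (b - d) := by field_simp; nlinarith
  have h2 := mul_integral_sub_mul_integral_eq_of_kink (φ := fun t => -φ t) (α := 1 / q - 1 / p)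
    (β := 1 / p) (κ := (p - q) / p ^ 2) hω hcont.neg hxd le_rfl hdb hl' (by ring)
    (by field_simp; nlinarith) h7 (by rw [h7]; field_simp; nlinarith)
    (fun t ht => hhigh t ht.1) fun t ht => hhigh t (hxd.trans ht.1)
  have hi : ∀ u v : ℝ, IntervalIntegrable φ volume u v := fun u v => hcont.intervalIntegrable u v
  have e1 := intervalIntegral.integral_add_adjacent_intervals (hi c x) (hi x d)
  have e2 := intervalIntegral.integral_add_adjacent_intervals (hi a c) (hi c d)
  have e3 := intervalIntegral.integral_add_adjacent_intervals (hi a d) (hi d b)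
  rw [intervalIntegral.integral_neg, intervalIntegral.integral_neg] at h2
  rw [sub_self] at h1 h2
  rw [hxq', hxb', mul_add, ← h1, ← h2, ← e3, ← e2, ← e1]
  ring

end Extremal

/-! ### Passage to the limit and transfer of the extremal functions to `X`. -/

namespace LSpace

variable {X : Type*} [AddCommMonoid X] [MetricSpace X] [LSpace X] {P : X → X}

theorem simpleIntegral_smul_const (hP : IsConvexifying P) {x : X} (hx : IsConvexElement x)
    (g : SimpleFunc ℝ ℝ) {ψ : ℝ → ℝ} (hψ : ∀ t, 0 ≤ ψ (g t)) (a b : ℝ) :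
    simpleIntegral P (g.map fun t => ψ t • x) a b = (∫ t in Icc a b, ψ (g t)) • x := by
  rw [simpleIntegral_eq_weightedSum, weightedSum_map hP, ← sum_measureReal_mul_eq_integral,
    hx.sum_smul]
  · refine Finset.sum_congr rfl fun y _ => ?_
    rw [hP.apply_eq_self (hx.smul _), smul_smul]
  · intro y hy
    obtain ⟨t, rfl⟩ := SimpleFunc.mem_range.1 hy
    exact mul_nonneg measureReal_nonneg (hψ t)

/-- Nonnegativity of `ψ` matters, because a convex element distributes only over nonnegative
scalars; isotropy makes `t ↦ ψ t • x` inherit the continuity of `ψ`. -/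
theorem integral_smul_const (hP : IsConvexifying P) (hX : Isotropic X) {x : X}
    (hx : IsConvexElement x) {ψ : ℝ → ℝ} {a b : ℝ} (hab : a ≤ b) (hψ : ContinuousOn ψ (Icc a b))
    (hψ0 : ∀ t ∈ Icc a b, 0 ≤ ψ t) :
    integral P (fun t => ψ t • x) a b = (∫ t in a..b, ψ t) • x := by
  have hf : ContinuousOn (fun t => ψ t • x) (Icc a b) := by
    intro s hs
    rw [ContinuousWithinAt, tendsto_iff_dist_tendsto_zero]
    have h1 : Tendsto (fun t => |ψ t - ψ s| * dist x 0) (𝓝[Icc a b] s) (𝓝 0) := by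
      have h2 : ContinuousWithinAt (fun t => |ψ t - ψ s| * dist x 0) (Icc a b) s :=
        ((hψ s hs).sub continuousWithinAt_const).abs.mul continuousWithinAt_const
      simpa [ContinuousWithinAt] using h2
    refine h1.congr' ?_
    filter_upwards [self_mem_nhdsWithin] with t ht
    rw [hx.dist_smul_smul hX (hψ0 t ht) (hψ0 s hs)]
  obtain ⟨g, hg, hgψ⟩ := exists_simpleFunc_tendstoUniformlyOn hab hψ
  have hgf : TendstoUniformlyOn (fun n => ⇑((g n).map fun t => ψ t • x)) (fun t => ψ t • x) atTop
      (Icc a b) := by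
    rw [Metric.tendstoUniformlyOn_iff] at hgψ ⊢
    intro ε hε
    have hpos : 0 < dist x 0 + 1 := by positivity
    filter_upwards [hgψ (ε / (dist x 0 + 1)) (by positivity)] with n hn t ht
    have h1 := hn t ht
    rw [Real.dist_eq, lt_div_iff₀ hpos] at h1
    change dist (ψ t • x) (ψ (g n t) • x) < ε
    rw [hx.dist_smul_smul hX (hψ0 t ht) (hψ0 _ (hg n t))]
    nlinarith [abs_nonneg (ψ t - ψ (g n t))]
  have hint : Tendsto (fun n => ∫ t in Icc a b, ψ (g n t)) atTop (𝓝 (∫ t in a..b, ψ t)) := by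
    rw [intervalIntegral.integral_of_le hab, ← integral_Icc_eq_integral_Ioc]
    rw [Metric.tendsto_atTop]
    intro ε hε
    rw [Metric.tendstoUniformlyOn_iff] at hgψ
    have hpos : 0 < b - a + 1 := by linarith
    obtain ⟨N, hN⟩ := eventually_atTop.1 (hgψ (ε / (b - a + 1)) (by positivity))
    refine ⟨N, fun n hn => ?_⟩
    rw [Real.dist_eq, ← integral_sub (integrable_comp_simpleFunc _ (g n) ψ) hψ.integrableOn_Icc,
      ← Real.norm_eq_abs]
    have h1 : ‖∫ t in Icc a b, (ψ (g n t) - ψ t)‖ ≤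
        ε / (b - a + 1) * volume.real (Icc a b) := by
      refine norm_setIntegral_le_of_norm_le_const (by simp) fun t ht => ?_
      have h2 := hN n hn t ht
      rw [dist_comm] at h2
      exact h2.le
    rw [Real.volume_real_Icc_of_le hab] at h1
    have h3 : ε / (b - a + 1) * (b - a + 1) = ε := by field_simp
    have h4 : 0 < ε / (b - a + 1) := by positivity
    linarith
  have hJ := (isIntegrable_of_continuousOn hP hab hf).hasIntegral.2 _ hgf
  refine tendsto_nhds_unique hJ ?_
  have hnn : 0 ≤ ∫ t in a..b, ψ t := intervalIntegral.integral_nonneg hab hψ0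
  rw [tendsto_iff_dist_tendsto_zero]
  have h1 := ((hint.sub_const (∫ t in a..b, ψ t)).abs.mul_const (dist x 0))
  rw [sub_self, abs_zero, zero_mul] at h1
  refine h1.congr fun n => ?_
  rw [simpleIntegral_smul_const hP hx (g n) (fun t => hψ0 _ (hg n t)),
    hx.dist_smul_smul hX (integral_nonneg fun t => hψ0 _ (hg n t)) hnn]

/-- A bound for the means of simple mappings passes to mappings of the class `H^ω`. -/
theorem dist_mean_le_of_simple (hP : IsConvexifying P) {ω : ℝ → ℝ} (hω : IsModulusOfContinuity ω)
    {a b c d e K : ℝ} (hab : a ≤ b) (hac : a ≤ c) (hcd : c ≤ d) (hbe : b ≤ e) (hde : d ≤ e)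
    (hK : ∀ (s : SimpleFunc ℝ X) (ε : ℝ), 0 ≤ ε →
      (∀ u ∈ Icc a e, ∀ v ∈ Icc a e, u ≤ v → dist (s u) (s v) ≤ ω (v - u) + ε) →
      dist ((1 / (b - a)) • simpleIntegral P s a b) ((1 / (d - c)) • simpleIntegral P s c d) ≤
        K + 2 * ε)
    {f : ℝ → X} (hf : f ∈ ClassH ω a e X) : dist (mean P f a b) (mean P f c d) ≤ K := by
  have hcont := continuousOn_of_mem_classH hω hf
  have hsub1 : Icc a b ⊆ Icc a e := Icc_subset_Icc le_rfl hbe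
  have hsub2 : Icc c d ⊆ Icc a e := Icc_subset_Icc hac hde
  obtain ⟨g, -, hg⟩ := exists_simpleFunc_tendstoUniformlyOn (hab.trans hbe) hcont
  have hs : TendstoUniformlyOn (fun n => ⇑((g n).map f)) f atTop (Icc a e) := hg
  have h1 := (isIntegrable_of_continuousOn hP hab (hcont.mono hsub1)).hasIntegral.2 _ (hs.mono hsub1)
  have h2 := (isIntegrable_of_continuousOn hP hcd (hcont.mono hsub2)).hasIntegral.2 _ (hs.mono hsub2)
  have h3 := (((continuous_real_smul (1 / (b - a))).tendsto _).comp h1).dist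
    (((continuous_real_smul (1 / (d - c))).tendsto _).comp h2)
  refine le_of_forall_pos_le_add fun ε hε => le_of_tendsto h3 ?_
  filter_upwards [Metric.tendstoUniformlyOn_iff.1 hs (ε / 4) (by positivity)] with n hn
  refine (hK ((g n).map f) (ε / 2) (by positivity) fun u hu v hv huv => ?_).trans (by linarith)
  have h4 := hn u hu
  have h5 := hn v hv
  have h6 := hf u hu v hv
  rw [abs_sub_comm, abs_of_nonneg (sub_nonneg.2 huv)] at h6
  rw [dist_comm] at h4
  linarith [dist_triangle ((g n).map f u) (f u) ((g n).map f v),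
    dist_triangle (f u) (f v) ((g n).map f v)]

/-- A real function with modulus `ω` yields a mapping of the class `H^ω` with the same difference
of the means. -/
theorem exists_mem_classH_dist_mean_eq (hP : IsConvexifying P) (hX : Isotropic X) {ω φ : ℝ → ℝ}
    (hω : IsModulusOfContinuity ω) {a b c d e : ℝ} (hab : a < b) (hac : a ≤ c) (hcd : c < d)
    (hbe : b ≤ e) (hde : d ≤ e) {x : X} (hx0 : x ≠ 0) (hx : IsConvexElement x)
    (hφ : HasModulus ω φ) :
    ∃ f ∈ ClassH ω a e X, dist (mean P f a b) (mean P f c d) =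
      |(1 / (d - c) * ∫ t in c..d, φ t) - 1 / (b - a) * ∫ t in a..b, φ t| := by
  have hcont := hφ.continuous hω
  set h := dist x 0 with hh
  have hpos : 0 < h := dist_pos.2 hx0
  -- The modulus gives `φ t ≥ φ a - ω (e - a)` on `[a, e]`, so `φ + C` is nonnegative there; `C`
  -- cancels in the difference of the means, and division by `h` normalises the ray.
  set C := ω (e - a) - φ a with hC
  have hφC : ∀ t ∈ Icc a e, 0 ≤ (φ t + C) / h := by
    intro t ht
    have h1 := hφ a t ht.1
    have h2 := hω.monotoneOn (mem_Ici.2 (sub_nonneg.2 ht.1))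
      (mem_Ici.2 (sub_nonneg.2 (ht.1.trans ht.2))) (by linarith [ht.2] : t - a ≤ e - a)
    refine div_nonneg ?_ hpos.le
    linarith [neg_abs_le (φ t - φ a)]
  have hint : ∀ u v : ℝ, u < v → Icc u v ⊆ Icc a e →
      mean P (fun t => ((φ t + C) / h) • x) u v =
        ((1 / (v - u) * (∫ t in u..v, φ t) + C) / h) • x := by
    intro u v huv hsub
    have hne : v - u ≠ 0 := by linarith
    rw [mean, integral_smul_const hP hX hx huv.le (by fun_prop) fun t ht => hφC t (hsub ht),
      smul_smul, intervalIntegral.integral_div, intervalIntegral.integral_add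
        (hcont.intervalIntegrable _ _) intervalIntegrable_const, intervalIntegral.integral_const,
      smul_eq_mul]
    congr 1
    field_simp
  have hnn : ∀ u v : ℝ, u < v → Icc u v ⊆ Icc a e →
      0 ≤ (1 / (v - u) * (∫ t in u..v, φ t) + C) / h := by
    intro u v huv hsub
    have h1 : 0 ≤ ∫ t in u..v, (φ t + C) / h :=
      intervalIntegral.integral_nonneg huv.le fun t ht => hφC t (hsub ht)
    rw [intervalIntegral.integral_div, intervalIntegral.integral_add
      (hcont.intervalIntegrable _ _) intervalIntegrable_const, intervalIntegral.integral_const,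
      smul_eq_mul] at h1
    have hvu : 0 < v - u := sub_pos.2 huv
    have h2 : (1 / (v - u) * (∫ t in u..v, φ t) + C) / h =
        1 / (v - u) * (((∫ t in u..v, φ t) + (v - u) * C) / h) := by field_simp
    rw [h2]
    positivity
  have hsub1 : Icc a b ⊆ Icc a e := Icc_subset_Icc le_rfl hbe
  have hsub2 : Icc c d ⊆ Icc a e := Icc_subset_Icc hac hde
  refine ⟨fun t => ((φ t + C) / h) • x, fun s hs t ht => ?_, ?_⟩
  · have h1 := hφ.mem_classH a e s hs t ht
    rw [hx.dist_smul_smul hX (hφC s hs) (hφC t ht), ← hh, ← sub_div, add_sub_add_right_eq_sub,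
      abs_div, abs_of_pos hpos, div_mul_cancel₀ _ hpos.ne']
    exact h1
  · rw [hint a b hab hsub1, hint c d hcd hsub2, hx.dist_smul_smul hX (hnn a b hab hsub1)
      (hnn c d hcd hsub2), ← hh, ← sub_div, add_sub_add_right_eq_sub, abs_div, abs_of_pos hpos,
      div_mul_cancel₀ _ hpos.ne', abs_sub_comm]

end LSpace

theorem mainTheorem3 {X : Type*} [AddCommMonoid X] [MetricSpace X] [LSpace X]
    (P : X → X) (hP : LSpace.IsConvexifying P)
    (ω : ℝ → ℝ) (hω : IsModulusOfContinuity ω)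
    (a b c d : ℝ) (hab : a < b) (hcd : c < d) (hac : a ≤ c)
    (M m : ℝ) (hM : M = max (b - a) (d - c)) (hm : m = min (b - a) (d - c))
    (K : ℝ)
    (hK :
      (Icc c d ⊆ Icc a b ∧
        K = (M - m) / M ^ 2 *
          (modulusIntegral ω 0 (M * (c - a) / (M - m)) +
            modulusIntegral ω 0 (M * (b - d) / (M - m)))) ∨
      (b ∈ Icc c d ∧
        K = 1 / (M + m) * modulusIntegral ω (M * (b - c) / m) (d - a) +
          (M - m) / M ^ 2 * modulusIntegral ω 0 (M * (b - c) / m)) ∨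
      (b ≤ c ∧
        K = 1 / (M + m) * modulusIntegral ω (c - b) (d - a))) :
    (∀ f ∈ ClassH ω a (max b d) X,
      LSpace.IsIntegrable P f a b ∧ LSpace.IsIntegrable P f c d ∧
      dist (LSpace.mean P f a b) (LSpace.mean P f c d) ≤ K) ∧
    (LSpace.Isotropic X → ConcaveOn ℝ (Ici 0) ω →
      (∃ x : X, x ≠ 0 ∧ IsAddUnit x ∧ LSpace.IsConvexElement x) →
      ∃ f ∈ ClassH ω a (max b d) X,
        dist (LSpace.mean P f a b) (LSpace.mean P f c d) = K) := by
  have hbe : b ≤ max b d := le_max_left b d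
  have hde : d ≤ max b d := le_max_right b d
  have hp0 : 0 < b - a := sub_pos.2 hab
  have hq0 : 0 < d - c := sub_pos.2 hcd
  have hMm : M + m = b - a + (d - c) := by rw [hM, hm, max_add_min]
  -- The error `2 * ε` allows for two pairings, each contributing at most `ε`.
  have key : (∀ (s : SimpleFunc ℝ X) (ε : ℝ), 0 ≤ ε →
      (∀ u ∈ Icc a (max b d), ∀ v ∈ Icc a (max b d), u ≤ v →
        dist (s u) (s v) ≤ ω (v - u) + ε) →
      dist ((1 / (b - a)) • LSpace.simpleIntegral P s a b)
        ((1 / (d - c)) • LSpace.simpleIntegral P s c d) ≤ K + 2 * ε) ∧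
      (ConcaveOn ℝ (Ici 0) ω → ∃ φ : ℝ → ℝ, HasModulus ω φ ∧
        (1 / (d - c) * ∫ t in c..d, φ t) - 1 / (b - a) * ∫ t in a..b, φ t = K) := by
    rcases hK with ⟨hsub, rfl⟩ | ⟨⟨hcb, hbd⟩, rfl⟩ | ⟨hbc, rfl⟩
    · have hdb : d ≤ b := (hsub ⟨hcd.le, le_rfl⟩).2
      rw [max_eq_left (by linarith)] at hM
      rw [min_eq_right (by linarith)] at hm
      rw [hM, hm]
      exact ⟨fun s ε hε hs => LSpace.dist_simpleMean_le_of_subset hP hω.continuousOn s rfl rfl hq0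
        hac hdb hbe hε hs, fun hc => exists_extremal_of_subset hω hc rfl rfl hq0 hac hdb⟩
    · rcases le_total (d - c) (b - a) with hle | hle
      · rw [max_eq_left hle] at hM
        rw [min_eq_right hle] at hm
        rw [hM, hm]
        exact ⟨fun s ε hε hs => LSpace.dist_simpleMean_le_of_overlap_ge hP hω.continuousOn s rfl
          rfl hq0 hle hcb hbd hde hε hs,
          fun hc => exists_extremal_of_overlap_ge hω hc rfl rfl hq0 hle hcb hbd⟩
      · rw [max_eq_right hle] at hM
        rw [min_eq_left hle] at hm
        rw [hM, hm]
        exact ⟨fun s ε hε hs => LSpace.dist_simpleMean_le_of_overlap_le hP hω.continuousOn s rfl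
          rfl hp0 hle hac hcb hde hε hs,
          fun hc => exists_extremal_of_overlap_le hω hc rfl rfl hp0 hle hac hcb⟩
    · rw [hMm]
      exact ⟨fun s ε hε hs => (LSpace.dist_simpleMean_le_of_disjoint hP hω.continuousOn s hab hcd
        hbc hde hε hs).trans (by linarith),
        fun hc => exists_extremal_of_disjoint hω hc rfl rfl hp0 hq0 hbc⟩
  have hbound : ∀ f ∈ ClassH ω a (max b d) X,
      dist (LSpace.mean P f a b) (LSpace.mean P f c d) ≤ K := fun f hf =>
    LSpace.dist_mean_le_of_simple hP hω hab.le hac hcd.le hbe hde key.1 hf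
  refine ⟨fun f hf => ?_, fun hX hc ⟨x, hx0, _, hx⟩ => ?_⟩
  · have hcont := LSpace.continuousOn_of_mem_classH hω hf
    exact ⟨LSpace.isIntegrable_of_continuousOn hP hab.le
        (hcont.mono (Icc_subset_Icc le_rfl hbe)),
      LSpace.isIntegrable_of_continuousOn hP hcd.le (hcont.mono (Icc_subset_Icc hac hde)),
      hbound f hf⟩
  · obtain ⟨φ, hφ, hφK⟩ := key.2 hc
    obtain ⟨f, hf, hfK⟩ := LSpace.exists_mem_classH_dist_mean_eq hP hX hω hab hac hcd hbe hde hx0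
      hx hφ
    -- The sign of `K` comes from the upper bound itself and removes the absolute value.
    have hK0 : 0 ≤ K := dist_nonneg.trans (hbound f hf)
    exact ⟨f, hf, by rw [hfK, hφK, abs_of_nonneg hK0]⟩
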